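/- Let $\mathbb S=\{e^{i\theta}\}$ be the unit circle; write $b(\theta)$ for $b(e^{i\theta})$. Let $\Lambda:C^\infty(\mathbb S)\to C^\infty(\mathbb S)$ be the Dirichlet-to-Neumann operator of the unit disk, $\Lambda e^{in\theta}=|n|e^{in\theta}$ for $n\in\mathbb Z$. For a positive function $a\in C^\infty(\mathbb S)$ let $0=\lambda_0(a)<\lambda_1(a)\le\lambda_2(a)\le\cdots$ be the eigenvalues of $\Lambda_a=a^{1/2}\Lambda a^{1/2}$, repeated according to multiplicity, let $\zeta_a(s)=\sum_{k\ge 1}\lambda_k(a)^{-s}$ for $\Re s>1$, and let $\zeta_R$ be the Riemann zeta function. Two positive functions $a,b\in C^\infty(\mathbb S)$ are called conformally equivalent if there is a conformal or anticonformal transformation $\Psi$ of the closed unit disk such that $b=|d\psi/d\theta|^{-1}\,a\circ\psi$, where $\psi$ is given by $e^{i\psi(\theta)}=\Psi(e^{i\theta})$. **Proposition 5.** Let $a\in C^\infty(\mathbb S)$ be positive and satisfy $$\frac1{2\pi}\int_0^{2\pi}\frac{d\theta}{a(\theta)}=1,$$ and assume that $a$ is not conformally equivalent to the constant function $\mathbf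 1$. Then there exists a positive real $s_a$ (which we take $>1$, so that $\zeta_a(s)$ is given by the convergent series above for $s\ge s_a$) such that $$(\zeta_a-2\zeta_R)''(s)>0\qquad\text{for all } s\in[s_a,+\infty).$$ -/

import Mathlib

open scoped ContDiff ComplexOrder

noncomputable section

namespace Steklov

instance instFactTwoPiPos : Fact ((0 : ℝ) < 2 * Real.pi) := ⟨Real.two_pi_pos⟩

/-- The unit circle, parametrized by the angle `θ ∈ ℝ / 2πℤ`. -/
abbrev S : Type := AddCircle (2 * Real.pi)

/-- `C^∞` functions on the circle: `θ ↦ u θ` is a smooth function of the real variable `θ`. -/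
def IsSmooth {E : Type*} [NormedAddCommGroup E] [NormedSpace ℝ E] (u : S → E) : Prop :=
  ContDiff ℝ ∞ (fun θ : ℝ => u (θ : S))

/-- The Dirichlet-to-Neumann operator of the unit disk, `Λ e^{inθ} = |n| e^{inθ}`. -/
def dtn (u : S → ℂ) (x : S) : ℂ :=
  ∑' n : ℤ, ((|n| : ℤ) : ℂ) * fourierCoeff u n * fourier n x

/-- The operator `Λ_a = a^{1/2} Λ a^{1/2}`. -/
def dtnWeighted (a : S → ℝ) (u : S → ℂ) (x : S) : ℂ :=
  (Real.sqrt (a x) : ℂ) * dtn (fun y => (Real.sqrt (a y) : ℂ) * u y) x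

/-- The sum of the eigenspaces of `Λ_a : C^∞(S) → C^∞(S)` for the eigenvalues `μ ≤ t`. Its dimension
is the number of eigenvalues `≤ t`, counted with multiplicity. -/
def eigenspaceLE (a : S → ℝ) (t : ℝ) : Submodule ℂ (S → ℂ) :=
  Submodule.span ℂ
    {u | IsSmooth u ∧ ∃ μ : ℝ, μ ≤ t ∧ ∀ x, dtnWeighted a u x = (μ : ℂ) * u x}

/-- `λ_k(a)`, the `k`-th eigenvalue (`k = 0, 1, 2, …`) of `Λ_a` in increasing order, each eigenvalue
repeated according to its multiplicity: the least `t` such that at least `k + 1` eigenvalues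
are `≤ t`. -/
def eigenvalue (a : S → ℝ) (k : ℕ) : ℝ :=
  sInf {t : ℝ | ((k + 1 : ℕ) : Cardinal) ≤ Module.rank ℂ (eigenspaceLE a t)}

/-- The zeta function `ζ_a(s) = ∑_{k ≥ 1} λ_k(a)^{-s}`, for `Re s > 1`. -/
def zeta (a : S → ℝ) (s : ℂ) : ℂ :=
  ∑' k : ℕ, (eigenvalue a (k + 1) : ℂ) ^ (-s)

/-- Conformal transformations of the closed unit disk: biholomorphisms of the open disk onto itself,
extended continuously to the boundary. -/
def IsConformalDiskMap (Ψ : ℂ → ℂ) : Prop :=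
  DifferentiableOn ℂ Ψ (Metric.ball 0 1) ∧
    Set.BijOn Ψ (Metric.ball 0 1) (Metric.ball 0 1) ∧
    ContinuousOn Ψ (Metric.closedBall 0 1)

/-- `a` and `b` are conformally equivalent: `b = |dψ/dθ|⁻¹ a ∘ ψ`, where `e^{iψ(θ)} = Ψ(e^{iθ})` for
a conformal or anticonformal transformation `Ψ` of the disk. -/
def ConformallyEquivalent (a b : S → ℝ) : Prop :=
  ∃ Ψ : ℂ → ℂ,
    (IsConformalDiskMap Ψ ∨ IsConformalDiskMap (fun z => (starRingEnd ℂ) (Ψ z))) ∧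
    ∃ ψ : ℝ → ℝ, ContDiff ℝ ∞ ψ ∧
      (∀ θ : ℝ, Complex.exp (Complex.I * ψ θ) = Ψ (Complex.exp (Complex.I * θ))) ∧
      ∀ θ : ℝ, b (θ : S) = |deriv ψ θ|⁻¹ * a (ψ θ : S)

end Steklov

end

/-! The point is Weinstock's inequality with its equality case: under the normalization of `a`,
`λ₁(a) < 1` unless `a` is conformally equivalent to `1`. Differentiating termwise, `ζ_a''(s) = ∑
(log λ_k)² λ_k^{-s}` is a series of nonnegative terms whose first term `(log λ₁)² λ₁^{-s}` tends to
infinity when `λ₁ < 1`, while `2 ζ_R''(s)` stays bounded for `s ≥ 2`. This is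
`exists_iteratedDeriv_two_pos`; it needs linear growth of the eigenvalues for convergence
(`exists_linear_le_eigenvalue`).

Put `ρ = 1/a`, a density of mean `1`. The operator `T = Λ^{-1/2} B Λ^{-1/2}` on `L²`, with `B f = ρ
(f - ∫ ρ f)`, is compact, symmetric and nonnegative, and an eigenvalue `κ > 0` of `T` yields the
eigenvalue `1/κ` of `Λ_a`, with a smooth eigenfunction by elliptic regularity. So `λ₁ < 1` follows
from `‖T‖ > 1` (`exists_lt_one_two_le_rank`).

To bound `‖T‖` from below, choose a Möbius map `v` of the disk whose boundary values satisfy `∫ ρ v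
= 0` (`exists_balanced`). It has modulus `1` on the circle and unit Dirichlet energy, so `w =
Λ^{1/2} v` is a unit vector with `⟨w, T w⟩ = ∫ ρ |v|² = 1`. If `‖T‖ ≤ 1`, then `T w = w`, that is `Λ
v = ρ v`. This determines `a`, and shows it to be conformally equivalent to `1`. -/

noncomputable section

namespace Steklov

open MeasureTheory AddCircle

/-! ### Fourier series of smooth functions on the circle. -/

section Smooth

variable {E : Type*} [NormedAddCommGroup E] [NormedSpace ℝ E]

theorem IsSmooth.continuous {u : S → E} (hu : IsSmooth u) : Continuous u :=
  continuous_coinduced_dom.mpr (ContDiff.continuous hu)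

theorem isSmooth_const (c : E) : IsSmooth (fun _ => c) := contDiff_const

theorem IsSmooth.add {u v : S → E} (hu : IsSmooth u) (hv : IsSmooth v) :
    IsSmooth (fun x => u x + v x) := ContDiff.add hu hv

theorem IsSmooth.sub {u v : S → E} (hu : IsSmooth u) (hv : IsSmooth v) :
    IsSmooth (fun x => u x - v x) := ContDiff.sub hu hv

theorem IsSmooth.mul {u v : S → ℂ} (hu : IsSmooth u) (hv : IsSmooth v) :
    IsSmooth (fun x => u x * v x) := ContDiff.mul hu hv

theorem IsSmooth.ofReal {u : S → ℝ} (hu : IsSmooth u) : IsSmooth (fun x => (u x : ℂ)) :=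
  Complex.ofRealCLM.contDiff.comp hu

theorem IsSmooth.sqrt {a : S → ℝ} (ha : IsSmooth a) (hpos : ∀ x, 0 < a x) :
    IsSmooth (fun x => √(a x)) :=
  ContDiff.sqrt ha fun _ => (hpos _).ne'

theorem IsSmooth.inv {a : S → ℝ} (ha : IsSmooth a) (hpos : ∀ x, 0 < a x) :
    IsSmooth (fun x => (a x)⁻¹) :=
  ContDiff.inv ha fun _ => (hpos _).ne'

end Smooth

theorem integrable_of_continuous {u : S → ℂ} (hu : Continuous u) :
    Integrable u haarAddCircle :=
  hu.integrable_of_hasCompactSupport (HasCompactSupport.of_compactSpace u)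

/-- The derivative of a smooth function on the circle. -/
theorem IsSmooth.exists_deriv {u : S → ℂ} (hu : IsSmooth u) :
    ∃ u' : S → ℂ, IsSmooth u' ∧
      ∀ n : ℤ, fourierCoeff u' n = Complex.I * n * fourierCoeff u n := by
  have hper : Function.Periodic (deriv fun θ : ℝ => u (θ : S)) (2 * Real.pi) := by
    intro θ
    rw [← deriv_comp_add_const]
    congr 1
    ext t
    simp
  refine ⟨hper.lift, ?_, fun n => ?_⟩
  · have : (fun θ : ℝ => hper.lift (θ : S)) = deriv fun θ : ℝ => u (θ : S) := by
      ext θ; exact hper.lift_coe θ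
    unfold IsSmooth
    rw [this]
    exact (contDiff_infty_iff_deriv.mp hu).2
  · have hd : ∀ θ : ℝ, HasDerivAt (fun θ : ℝ => u (θ : S)) (hper.lift (θ : S)) θ := by
      intro θ
      rw [hper.lift_coe θ]
      exact (contDiff_infty_iff_deriv.mp hu).1.differentiableAt.hasDerivAt
    have hc : Continuous (deriv fun θ : ℝ => u (θ : S)) :=
      (contDiff_infty_iff_deriv.mp hu).2.continuous
    rw [fourierCoeff_eq_intervalIntegral _ _ 0, fourierCoeff_eq_intervalIntegral _ _ 0]
    have hparts := intervalIntegral.integral_mul_deriv_eq_deriv_mul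
      (a := 0) (b := 0 + 2 * Real.pi)
      (u := fun y : ℝ => fourier (-n) (y : S))
      (v := fun θ : ℝ => u (θ : S))
      (fun x _ => hasDerivAt_fourier_neg (2 * Real.pi) n x) (fun x _ => hd x)
      (Continuous.intervalIntegrable (by
        refine continuous_const.mul ?_
        exact (map_continuous (fourier (-n))).comp (AddCircle.continuous_mk' _)) _ _)
      (Continuous.intervalIntegrable (by
        have : (fun θ : ℝ => hper.lift (θ : S)) = deriv fun θ : ℝ => u (θ : S) := by
          ext θ; exact hper.lift_coe θ
        rw [this]; exact hc) _ _)
    simp only [smul_eq_mul]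
    rw [hparts]
    have h2 : ((0 + 2 * Real.pi : ℝ) : S) = ((0 : ℝ) : S) := by simp
    rw [h2, sub_self, zero_sub, ← intervalIntegral.integral_neg]
    rw [mul_smul_comm, ← intervalIntegral.integral_const_mul]
    congr 2
    ext x
    have : (Real.pi : ℂ) ≠ 0 := by exact_mod_cast Real.pi_ne_zero
    push_cast
    field_simp

theorem norm_fourier_apply (n : ℤ) (x : S) : ‖fourier n x‖ = 1 := by
  rw [fourier_apply, Circle.norm_coe]

theorem norm_fourierCoeff_le {u : S → ℂ} {C : ℝ} (h : ∀ x, ‖u x‖ ≤ C) (n : ℤ) :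
    ‖fourierCoeff u n‖ ≤ C := by
  have := norm_integral_le_of_norm_le_const (μ := haarAddCircle)
    (f := fun t : S => fourier (-n) t • u t) (C := C)
    (Filter.Eventually.of_forall fun x => by
      rw [norm_smul, norm_fourier_apply, one_mul]; exact h x)
  simpa [fourierCoeff] using this

/-- Rapidly decreasing sequences on `ℤ`. -/
def RapidDecay (c : ℤ → ℂ) : Prop :=
  ∀ k : ℕ, ∃ C : ℝ, ∀ n : ℤ, (1 + |(n : ℝ)|) ^ k * ‖c n‖ ≤ C

/-- Each extra power of `1 + |n|` is paid for by one derivative, so the induction must range over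
all smooth functions. -/
theorem IsSmooth.rapidDecay {u : S → ℂ} (hu : IsSmooth u) : RapidDecay (fourierCoeff u) := by
  intro k
  induction k generalizing u with
  | zero =>
    obtain ⟨C, hC⟩ := (isCompact_range hu.continuous).isBounded.exists_norm_le
    exact ⟨C, fun n => by simpa using norm_fourierCoeff_le (fun x => hC _ ⟨x, rfl⟩) n⟩
  | succ k ih =>
    obtain ⟨u', hu', h⟩ := hu.exists_deriv
    obtain ⟨C, hC⟩ := ih hu
    obtain ⟨C', hC'⟩ := ih hu'
    refine ⟨C + C', fun n => ?_⟩
    have h1 := hC n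
    have h2 := hC' n
    rw [h n, norm_mul, norm_mul, Complex.norm_I, one_mul, Complex.norm_intCast] at h2
    calc _ = (1 + |(n : ℝ)|) ^ k * ‖fourierCoeff u n‖ +
          (1 + |(n : ℝ)|) ^ k * (|(n : ℝ)| * ‖fourierCoeff u n‖) := by ring
      _ ≤ _ := add_le_add h1 h2

theorem summable_inv_one_add_sq : Summable fun n : ℤ => ((1 + |(n : ℝ)|) ^ 2)⁻¹ := by
  have h : Summable fun n : ℤ => 1 / (n : ℝ) ^ 2 :=
    Real.summable_one_div_int_pow.mpr one_lt_two
  have h0 : Summable fun n : ℤ => (if n = 0 then (1 : ℝ) else 0) :=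
    summable_of_ne_finset_zero (s := {0}) (by simp +contextual)
  refine Summable.of_nonneg_of_le (fun n => by positivity) (fun n => ?_) (h.add h0)
  by_cases hn : n = 0
  · simp [hn]
  · have : 0 < |(n : ℝ)| := by simpa using hn
    simp only [hn, if_false, add_zero, one_div]
    rw [← sq_abs (n : ℝ)]
    gcongr
    linarith

theorem RapidDecay.summable_pow_mul {c : ℤ → ℂ} (hc : RapidDecay c) (k : ℕ) :
    Summable fun n : ℤ => (1 + |(n : ℝ)|) ^ k * ‖c n‖ := by
  obtain ⟨C, hC⟩ := hc (k + 2)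
  refine Summable.of_nonneg_of_le (fun n => by positivity) (fun n => ?_)
    (summable_inv_one_add_sq.mul_left C)
  rw [← div_eq_mul_inv, le_div_iff₀ (by positivity)]
  calc _ = (1 + |(n : ℝ)|) ^ (k + 2) * ‖c n‖ := by ring
    _ ≤ C := hC n

theorem RapidDecay.summable_norm {c : ℤ → ℂ} (hc : RapidDecay c) : Summable fun n => ‖c n‖ := by
  simpa using hc.summable_pow_mul 0

theorem RapidDecay.abs_mul {c : ℤ → ℂ} (hc : RapidDecay c) :
    RapidDecay fun n => ((|n| : ℤ) : ℂ) * c n := by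
  intro k
  obtain ⟨C, hC⟩ := hc (k + 1)
  refine ⟨C, fun n => le_trans ?_ (hC n)⟩
  rw [norm_mul, Complex.norm_intCast]
  simp only [Int.cast_abs, abs_abs]
  rw [pow_succ, mul_assoc]
  gcongr
  linarith

/-- The exact norm supplies the summable bounds needed to differentiate a Fourier series termwise to
every order. -/
theorem iteratedFDeriv_const_mul_fourier_norm (c : ℂ) (n : ℤ) (k : ℕ) (x : ℝ) :
    ‖iteratedFDeriv ℝ k (fun θ : ℝ => c * fourier n (θ : S)) x‖ = |(n : ℝ)| ^ k * ‖c‖ := by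
  rw [norm_iteratedFDeriv_eq_norm_iteratedDeriv]
  have : iteratedDeriv k (fun θ : ℝ => c * fourier n (θ : S)) =
      fun θ : ℝ => ((Complex.I * n) ^ k * c) * fourier n (θ : S) := by
    induction k with
    | zero => simp
    | succ k ih =>
      rw [iteratedDeriv_succ, ih]
      ext θ
      rw [((hasDerivAt_fourier (2 * Real.pi) n θ).const_mul _).deriv]
      have : (Real.pi : ℂ) ≠ 0 := by exact_mod_cast Real.pi_ne_zero
      push_cast
      field_simp
      ring
  rw [this]
  simp only [norm_mul, norm_pow, Complex.norm_I, one_mul, Complex.norm_intCast,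
    norm_fourier_apply, mul_one]

theorem RapidDecay.isSmooth_tsum {c : ℤ → ℂ} (hc : RapidDecay c) :
    IsSmooth fun x : S => ∑' n : ℤ, c n * fourier n x := by
  refine contDiff_tsum (v := fun k (n : ℤ) => (1 + |(n : ℝ)|) ^ k * ‖c n‖) (fun n => ?_)
    (fun k _ => hc.summable_pow_mul k) (fun k n x _ => ?_)
  · simp_rw [fourier_coe_apply]
    refine contDiff_const.mul ?_
    refine Complex.contDiff_exp.comp ?_
    refine ContDiff.div_const ?_ _
    exact contDiff_const.mul Complex.ofRealCLM.contDiff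
  · rw [iteratedFDeriv_const_mul_fourier_norm]
    gcongr
    linarith

theorem fourierCoeff_tsum {c : ℤ → ℂ} (hc : Summable fun n => ‖c n‖) (n : ℤ) :
    fourierCoeff (fun x : S => ∑' m : ℤ, c m * fourier m x) n = c n := by
  unfold fourierCoeff
  simp only [smul_eq_mul, ← tsum_mul_left]
  rw [← integral_tsum_of_summable_integral_norm]
  · rw [tsum_eq_single n]
    · have : ∀ t : S, fourier (-n) t * (c n * fourier n t) = c n := by
        intro t
        rw [mul_left_comm, ← fourier_add]; simp
      simp_rw [this]
      simp
    · intro m hm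
      have h := congrFun (fourierCoeff_fourier (T := 2 * Real.pi) m) n
      rw [Pi.single_eq_of_ne hm.symm] at h
      unfold fourierCoeff at h
      simp only [smul_eq_mul] at h
      have : ∀ t : S, fourier (-n) t * (c m * fourier m t) =
          c m * (fourier (-n) t * fourier m t) := fun t => by ring
      simp_rw [this]
      rw [integral_const_mul, h, mul_zero]
  · intro m
    exact integrable_of_continuous (by fun_prop)
  · simpa only [norm_mul, norm_fourier_apply, one_mul, mul_one, integral_const, probReal_univ,
      one_smul] using hc

theorem IsSmooth.hasSum_fourier {u : S → ℂ} (hu : IsSmooth u) (x : S) :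
    HasSum (fun n => fourierCoeff u n * fourier n x) (u x) := by
  have := has_pointwise_sum_fourier_series_of_summable (f := ⟨u, hu.continuous⟩)
    (Summable.of_norm hu.rapidDecay.summable_norm) x
  simpa using this

/-! ### Passage to the Hilbert space `L²`. -/

/-- The class in `L²` of a continuous function on the circle. -/
def toL2 (u : S → ℂ) (hu : Continuous u) : Lp ℂ 2 (haarAddCircle (T := 2 * Real.pi)) :=
  ContinuousMap.toLp 2 haarAddCircle ℂ ⟨u, hu⟩

theorem coeFn_toL2 (u : S → ℂ) (hu : Continuous u) : toL2 u hu =ᵐ[haarAddCircle] u :=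
  ContinuousMap.coeFn_toLp (𝕜 := ℂ) haarAddCircle ⟨u, hu⟩

theorem repr_toL2 (u : S → ℂ) (hu : Continuous u) (n : ℤ) :
    fourierBasis.repr (toL2 u hu) n = fourierCoeff u n := by
  rw [fourierBasis_repr]
  exact fourierCoeff_toLp ⟨u, hu⟩ n

theorem inner_toL2 (u v : S → ℂ) (hu : Continuous u) (hv : Continuous v) :
    inner ℂ (toL2 u hu) (toL2 v hv) = ∫ x, v x * starRingEnd ℂ (u x) ∂haarAddCircle :=
  ContinuousMap.inner_toLp haarAddCircle ⟨u, hu⟩ ⟨v, hv⟩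

theorem hasSum_inner (f g : Lp ℂ 2 (haarAddCircle (T := 2 * Real.pi))) :
    HasSum (fun n => starRingEnd ℂ (fourierBasis.repr f n) * fourierBasis.repr g n)
      (inner ℂ f g) := by
  have := fourierBasis.hasSum_inner_mul_inner f g
  simpa only [fourierBasis.repr_apply_apply, inner_conj_symm] using this

/-- The square-integrable functions on the circle. -/
abbrev L2 : Type := Lp ℂ 2 (haarAddCircle (T := 2 * Real.pi))

/-- The space `C^∞(S)`. -/
def smoothFun : Submodule ℂ (S → ℂ) where
  carrier := {u | IsSmooth u}
  add_mem' hu hv := IsSmooth.add hu hv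
  zero_mem' := isSmooth_const 0
  smul_mem' c _ hu := (isSmooth_const c).mul hu

theorem continuous_of_smoothFun (u : smoothFun) : Continuous u.1 := IsSmooth.continuous u.2

/-- The inclusion of `C^∞(S)` into `L²(S)`. -/
def smoothToL2 : smoothFun →ₗ[ℂ] L2 where
  toFun u := toL2 u.1 (continuous_of_smoothFun u)
  map_add' _ _ := rfl
  map_smul' _ _ := rfl

theorem inner_self_eq_ofReal (f : L2) : inner ℂ f f = ((‖f‖ ^ 2 : ℝ) : ℂ) := by
  rw [inner_self_eq_norm_sq_to_K]
  push_cast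
  rfl

theorem toL2_eq_zero {u : S → ℂ} {hu : Continuous u} (h : toL2 u hu = 0) (x : S) : u x = 0 := by
  have : (⟨u, hu⟩ : C(S, ℂ)) = 0 := by
    apply ContinuousMap.toLp_injective (p := 2) (𝕜 := ℂ) (E := ℂ)
      (haarAddCircle (T := 2 * Real.pi))
    rw [map_zero]
    exact h
  exact DFunLike.congr_fun this x

theorem IsSmooth.dtn {v : S → ℂ} (hv : IsSmooth v) : IsSmooth (dtn v) :=
  hv.rapidDecay.abs_mul.isSmooth_tsum

theorem IsSmooth.fourierCoeff_dtn {v : S → ℂ} (hv : IsSmooth v) (n : ℤ) :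
    fourierCoeff (Steklov.dtn v) n = ((|n| : ℤ) : ℂ) * fourierCoeff v n :=
  fourierCoeff_tsum hv.rapidDecay.abs_mul.summable_norm n

theorem IsSmooth.dtn_add {v w : S → ℂ} (hv : IsSmooth v) (hw : IsSmooth w) (x : S) :
    Steklov.dtn (fun y => v y + w y) x = Steklov.dtn v x + Steklov.dtn w x := by
  have hsum : ∀ {u : S → ℂ}, IsSmooth u →
      Summable fun n : ℤ => ((|n| : ℤ) : ℂ) * fourierCoeff u n * fourier n x := by
    intro u hu
    refine Summable.of_norm ?_
    simpa only [norm_mul, norm_fourier_apply, mul_one] using hu.rapidDecay.abs_mul.summable_norm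
  unfold Steklov.dtn
  rw [← (hsum hv).tsum_add (hsum hw)]
  refine tsum_congr fun n => ?_
  have := congrFun (fourierCoeff.add (integrable_of_continuous hv.continuous)
    (integrable_of_continuous hw.continuous)) n
  change fourierCoeff (fun y => v y + w y) n = _ at this
  rw [this, Pi.add_apply]
  ring

theorem dtn_const_mul (c : ℂ) (v : S → ℂ) (x : S) :
    Steklov.dtn (fun y => c * v y) x = c * Steklov.dtn v x := by
  unfold Steklov.dtn
  rw [← tsum_mul_left]
  refine tsum_congr fun n => ?_
  rw [fourierCoeff.const_mul]
  ring

/-! ### The quadratic form of `Λ_a` and upper bounds for the number of eigenvalues. -/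

section Weighted

variable {a : S → ℝ} (ha : IsSmooth a) (hpos : ∀ x, 0 < a x)

/-- Multiplication by `a^{1/2}` on `C^∞(S)`. -/
def sqrtMul : smoothFun →ₗ[ℂ] smoothFun where
  toFun u := ⟨fun x => (√(a x) : ℂ) * u.1 x, (ha.sqrt hpos).ofReal.mul u.2⟩
  map_add' u v := by ext x; exact mul_add _ _ _
  map_smul' c u := by ext x; exact mul_left_comm _ _ _

/-- The operator `Λ` on `C^∞(S)`. -/
def dtnLin : smoothFun →ₗ[ℂ] smoothFun where
  toFun u := ⟨dtn u.1, u.2.dtn⟩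
  map_add' u v := by ext x; exact u.2.dtn_add v.2 x
  map_smul' c u := by ext x; exact dtn_const_mul c u.1 x

/-- The operator `Λ_a` on `C^∞(S)`. -/
def dtnWeightedLin : smoothFun →ₗ[ℂ] smoothFun :=
  sqrtMul ha hpos ∘ₗ dtnLin ∘ₗ sqrtMul ha hpos

theorem inner_smoothToL2_sqrtMul (u v : smoothFun) :
    inner ℂ (smoothToL2 u) (smoothToL2 (sqrtMul ha hpos v)) =
      inner ℂ (smoothToL2 (sqrtMul ha hpos u)) (smoothToL2 v) := by
  change inner ℂ (toL2 _ _) (toL2 _ _) = inner ℂ (toL2 _ _) (toL2 _ _)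
  rw [inner_toL2, inner_toL2]
  congr 1
  ext x
  simp only [sqrtMul, LinearMap.coe_mk, AddHom.coe_mk, map_mul, Complex.conj_ofReal]
  ring

/-- Parseval, after moving one factor `a^{1/2}` to the other side. Symmetry of `Λ_a` and the lower
bound for its form are both read off from this series. -/
theorem hasSum_inner_dtnWeightedLin (u v : smoothFun) :
    HasSum (fun n : ℤ => ((|(n : ℝ)| : ℝ) : ℂ) *
        (starRingEnd ℂ (fourierCoeff (sqrtMul ha hpos u).1 n) *
          fourierCoeff (sqrtMul ha hpos v).1 n))
      (inner ℂ (smoothToL2 u) (smoothToL2 (dtnWeightedLin ha hpos v))) := by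
  rw [dtnWeightedLin, LinearMap.comp_apply, LinearMap.comp_apply, inner_smoothToL2_sqrtMul]
  have := hasSum_inner (smoothToL2 (sqrtMul ha hpos u))
    (smoothToL2 (dtnLin (sqrtMul ha hpos v)))
  convert this using 1
  ext n
  change _ = starRingEnd ℂ (fourierBasis.repr (toL2 _ _) n) * fourierBasis.repr (toL2 _ _) n
  rw [repr_toL2, repr_toL2]
  change _ = _ * fourierCoeff (dtn _) n
  rw [IsSmooth.fourierCoeff_dtn (sqrtMul ha hpos v).2, ← Int.cast_abs, Complex.ofReal_intCast]
  ring

theorem inner_dtnWeightedLin_symm (u v : smoothFun) :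
    inner ℂ (smoothToL2 (dtnWeightedLin ha hpos u)) (smoothToL2 v) =
      inner ℂ (smoothToL2 u) (smoothToL2 (dtnWeightedLin ha hpos v)) := by
  rw [← inner_conj_symm]
  have h := (hasSum_inner_dtnWeightedLin ha hpos v u)
  have h' := h.map (starRingEnd ℂ) Complex.continuous_conj
  refine h'.unique ?_
  convert hasSum_inner_dtnWeightedLin ha hpos u v using 1
  ext n
  simp only [Function.comp_apply, map_mul, Complex.conj_ofReal, Complex.conj_conj]
  ring

/-- The sum of the eigenspaces of `Λ_a` in `C^∞(S)` for the eigenvalues `≤ t`. -/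
def smoothEigenspaceLE (t : ℝ) : Submodule ℂ smoothFun :=
  ⨆ μ : {μ : ℝ // μ ≤ t}, Module.End.eigenspace (dtnWeightedLin ha hpos) (μ.1 : ℂ)

/-- On arbitrary functions `dtn` is a possibly divergent sum, hence not linear; on `smoothFun` it is
an endomorphism, so eigenspaces in the sense of linear algebra become available. -/
theorem eigenspaceLE_eq_map (t : ℝ) :
    eigenspaceLE a t = (smoothEigenspaceLE ha hpos t).map smoothFun.subtype := by
  apply le_antisymm
  · refine Submodule.span_le.mpr ?_
    rintro u ⟨hu, μ, hμ, h⟩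
    refine ⟨⟨u, hu⟩, ?_, rfl⟩
    refine Submodule.mem_iSup_of_mem (⟨μ, hμ⟩ : {μ : ℝ // μ ≤ t}) ?_
    refine Module.End.mem_eigenspace_iff.mpr ?_
    ext x
    exact h x
  · rw [smoothEigenspaceLE, Submodule.map_iSup]
    refine iSup_le fun μ => ?_
    rintro _ ⟨u, hu, rfl⟩
    refine Submodule.subset_span ⟨u.2, μ.1, μ.2, fun x => ?_⟩
    have := Module.End.mem_eigenspace_iff.mp hu
    exact congrFun (congrArg Subtype.val this) x

theorem inner_eq_zero_of_eigenvalue_ne {μ ν : ℝ} (hμν : μ ≠ ν) {u v : smoothFun}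
    (hu : dtnWeightedLin ha hpos u = (μ : ℂ) • u) (hv : dtnWeightedLin ha hpos v = (ν : ℂ) • v) :
    inner ℂ (smoothToL2 u) (smoothToL2 v) = 0 := by
  have h := inner_dtnWeightedLin_symm ha hpos u v
  rw [hu, hv, map_smul, map_smul, inner_smul_left, inner_smul_right, Complex.conj_ofReal] at h
  have h' : ((μ : ℂ) - ν) * inner ℂ (smoothToL2 u) (smoothToL2 v) = 0 := by
    rw [sub_mul, h, sub_self]
  refine (mul_eq_zero.mp h').resolve_left ?_
  rw [← ne_eq, sub_ne_zero]
  exact_mod_cast hμν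

/-- Eigenvectors for distinct eigenvalues are orthogonal, so the form is diagonal on a finite sum of
them. -/
theorem re_inner_dtnWeightedLin_le {t : ℝ} {u : smoothFun}
    (hu : u ∈ smoothEigenspaceLE ha hpos t) :
    (inner ℂ (smoothToL2 u) (smoothToL2 (dtnWeightedLin ha hpos u))).re ≤
      t * ‖smoothToL2 u‖ ^ 2 := by
  obtain ⟨f, hf, rfl⟩ := (Submodule.mem_iSup_iff_exists_finsupp _ _).mp hu
  have hf' : ∀ μ, dtnWeightedLin ha hpos (f μ) = ((μ.1 : ℝ) : ℂ) • f μ :=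
    fun μ => Module.End.mem_eigenspace_iff.mp (hf μ)
  have horth : ∀ μ ν, μ ≠ ν → inner ℂ (smoothToL2 (f μ)) (smoothToL2 (f ν)) = 0 :=
    fun μ ν h => inner_eq_zero_of_eigenvalue_ne ha hpos
      (fun h' => h (Subtype.ext h')) (hf' μ) (hf' ν)
  have h1 : inner ℂ (smoothToL2 (f.sum fun _ x => x))
      (smoothToL2 (dtnWeightedLin ha hpos (f.sum fun _ x => x))) =
      ∑ μ ∈ f.support, ((μ.1 * ‖smoothToL2 (f μ)‖ ^ 2 : ℝ) : ℂ) := by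
    simp only [Finsupp.sum, map_sum, hf', map_smul, sum_inner, inner_sum, inner_smul_right]
    refine Finset.sum_congr rfl fun μ hμ => ?_
    rw [Finset.sum_eq_single_of_mem μ hμ]
    · rw [inner_self_eq_ofReal]; push_cast; rfl
    · intro ν _ hν
      rw [horth _ _ hν]
  have h2 : ‖smoothToL2 (f.sum fun _ x => x)‖ ^ 2 =
      ∑ μ ∈ f.support, ‖smoothToL2 (f μ)‖ ^ 2 := by
    have : inner ℂ (smoothToL2 (f.sum fun _ x => x)) (smoothToL2 (f.sum fun _ x => x)) =
        ∑ μ ∈ f.support, ((‖smoothToL2 (f μ)‖ ^ 2 : ℝ) : ℂ) := by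
      simp only [Finsupp.sum, map_sum, sum_inner, inner_sum]
      refine Finset.sum_congr rfl fun μ hμ => ?_
      rw [Finset.sum_eq_single_of_mem μ hμ]
      · rw [inner_self_eq_ofReal]
      · intro ν _ hν
        rw [horth _ _ hν]
    rw [inner_self_eq_ofReal] at this
    exact_mod_cast this
  rw [h1, h2, ← Complex.ofReal_sum, Complex.ofReal_re, Finset.mul_sum]
  exact Finset.sum_le_sum fun μ _ => mul_le_mul_of_nonneg_right μ.2 (by positivity)

/-- The low Fourier coefficients of `a^{1/2} u`. -/
def lowCoeff (N : ℕ) : smoothFun →ₗ[ℂ] (Finset.Icc (-(N : ℤ)) N → ℂ) where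
  toFun u n := fourierCoeff (sqrtMul ha hpos u).1 n
  map_add' u v := by
    ext n
    rw [map_add]
    exact congrFun (fourierCoeff.add
      (integrable_of_continuous (continuous_of_smoothFun (sqrtMul ha hpos u)))
      (integrable_of_continuous (continuous_of_smoothFun (sqrtMul ha hpos v)))) n
  map_smul' c u := by
    ext n
    rw [map_smul]
    exact fourierCoeff.const_smul _ c n

/-- Only frequencies `|n| ≥ N + 1` survive in `a^{1/2} u`, and `‖a^{1/2} u‖² ≥ m ‖u‖²`. -/
theorem le_re_inner_dtnWeightedLin {m : ℝ} (hm : ∀ x, m ≤ a x) {N : ℕ} {u : smoothFun}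
    (hu : lowCoeff ha hpos N u = 0) :
    (N + 1) * m * ‖smoothToL2 u‖ ^ 2 ≤
      (inner ℂ (smoothToL2 u) (smoothToL2 (dtnWeightedLin ha hpos u))).re := by
  set c := fourierCoeff (sqrtMul ha hpos u).1 with hc
  have h1 : HasSum (fun n : ℤ => |(n : ℝ)| * ‖c n‖ ^ 2)
      (inner ℂ (smoothToL2 u) (smoothToL2 (dtnWeightedLin ha hpos u))).re := by
    have := Complex.hasSum_re (hasSum_inner_dtnWeightedLin ha hpos u u)
    convert this using 1
    ext n
    rw [← Complex.normSq_eq_conj_mul_self, Complex.normSq_eq_norm_sq, ← Complex.ofReal_mul,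
      Complex.ofReal_re]
  have h2 : HasSum (fun n : ℤ => ‖c n‖ ^ 2) (‖smoothToL2 (sqrtMul ha hpos u)‖ ^ 2) := by
    have := hasSum_inner (smoothToL2 (sqrtMul ha hpos u)) (smoothToL2 (sqrtMul ha hpos u))
    rw [inner_self_eq_ofReal] at this
    have := Complex.hasSum_re this
    convert this using 1
    · ext n
      change _ = (starRingEnd ℂ (fourierBasis.repr (toL2 _ _) n) *
        fourierBasis.repr (toL2 _ _) n).re
      rw [repr_toL2, ← Complex.normSq_eq_conj_mul_self, Complex.normSq_eq_norm_sq,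
        Complex.ofReal_re]
    · rw [Complex.ofReal_re]
  have h3 : (N + 1) * ‖smoothToL2 (sqrtMul ha hpos u)‖ ^ 2 ≤
      (inner ℂ (smoothToL2 u) (smoothToL2 (dtnWeightedLin ha hpos u))).re := by
    refine hasSum_le (fun n => ?_) (h2.mul_left ((N : ℝ) + 1)) h1
    by_cases hn : n ∈ Finset.Icc (-(N : ℤ)) N
    · have : c n = 0 := congrFun hu ⟨n, hn⟩
      simp [this]
    · gcongr
      rw [Finset.mem_Icc, ← abs_le] at hn
      have : (N : ℤ) + 1 ≤ |n| := by omega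
      exact_mod_cast this
  have h4 : m * ‖smoothToL2 u‖ ^ 2 ≤ ‖smoothToL2 (sqrtMul ha hpos u)‖ ^ 2 := by
    have e1 : ∀ v : smoothFun, ‖smoothToL2 v‖ ^ 2 = ∫ x, ‖v.1 x‖ ^ 2 ∂haarAddCircle := by
      intro v
      have := inner_toL2 v.1 v.1 (continuous_of_smoothFun v) (continuous_of_smoothFun v)
      rw [inner_self_eq_ofReal] at this
      simp only [Complex.mul_conj, Complex.normSq_eq_norm_sq] at this
      rw [integral_complex_ofReal] at this
      exact_mod_cast this
    rw [e1, e1, ← integral_const_mul]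
    have hint : ∀ g : S → ℝ, Continuous g → Integrable g haarAddCircle := fun g hg =>
      hg.integrable_of_hasCompactSupport (HasCompactSupport.of_compactSpace g)
    refine integral_mono (hint _ ?_) (hint _ ?_) fun x => ?_
    · exact continuous_const.mul ((continuous_of_smoothFun u).norm.pow 2)
    · exact (continuous_of_smoothFun (sqrtMul ha hpos u)).norm.pow 2
    · change m * ‖u.1 x‖ ^ 2 ≤ ‖(√(a x) : ℂ) * u.1 x‖ ^ 2
      rw [norm_mul, mul_pow, Complex.norm_real, Real.norm_eq_abs, sq_abs, Real.sq_sqrt (hpos x).le]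
      exact mul_le_mul_of_nonneg_right (hm x) (by positivity)
  calc _ = (N + 1) * (m * ‖smoothToL2 u‖ ^ 2) := by ring
    _ ≤ (N + 1) * ‖smoothToL2 (sqrtMul ha hpos u)‖ ^ 2 := by gcongr
    _ ≤ _ := h3

end Weighted

/-- A vector of the spectral subspace with vanishing low coefficients would have Rayleigh quotient
both at most `t` and at least `(N + 1) m`. So the `2N + 1` low coefficients determine it. -/
theorem rank_eigenspaceLE_le {a : S → ℝ} (ha : IsSmooth a) (hpos : ∀ x, 0 < a x)
    {m t : ℝ} (hm : ∀ x, m ≤ a x) {N : ℕ}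
    (ht : t < (N + 1) * m) : Module.rank ℂ (eigenspaceLE a t) ≤ (2 * N + 1 : ℕ) := by
  rw [eigenspaceLE_eq_map ha hpos]
  refine (rank_map_le _ _).trans ?_
  have hinj : Function.Injective
      ((lowCoeff ha hpos N).domRestrict (smoothEigenspaceLE ha hpos t)) := by
    refine (injective_iff_map_eq_zero _).mpr ?_
    rintro ⟨u, hu⟩ h0
    have h1 := re_inner_dtnWeightedLin_le ha hpos hu
    have h2 := le_re_inner_dtnWeightedLin ha hpos hm (N := N) (u := u) h0
    have h3 : ‖smoothToL2 u‖ ^ 2 = 0 := by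
      by_contra h
      have : 0 < ‖smoothToL2 u‖ ^ 2 := lt_of_le_of_ne (by positivity) (Ne.symm h)
      nlinarith
    have h4 : smoothToL2 u = 0 := by simpa using h3
    ext x
    exact toL2_eq_zero h4 x
  have := LinearMap.rank_le_of_injective _ hinj
  refine this.trans (le_of_eq ?_)
  rw [rank_fun', Fintype.card_coe, Int.card_Icc]
  congr 1
  omega

theorem le_of_le_rank_eigenspaceLE {a : S → ℝ} (ha : IsSmooth a) (hpos : ∀ x, 0 < a x)
    {m t : ℝ} (hm : ∀ x, m ≤ a x) {N : ℕ}
    (h : ((2 * N + 2 : ℕ) : Cardinal) ≤ Module.rank ℂ (eigenspaceLE a t)) :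
    (N + 1) * m ≤ t := by
  by_contra! ht
  have := h.trans (rank_eigenspaceLE_le ha hpos hm ht)
  rw [Nat.cast_le] at this
  omega

/-! ### Fourier multipliers and the compactness of `Λ^{-1/2}`. -/

/-- The operator on `L²` multiplying the `n`-th Fourier coefficient by `d n`. -/
def fourierMultiplier (d : ℤ → ℂ) {K : ℝ} (hK : 0 ≤ K) (hd : ∀ n, ‖d n‖ ≤ K) : L2 →L[ℂ] L2 :=
  fourierBasis.repr.symm.toContinuousLinearEquiv.toContinuousLinearMap ∘L
    lp.mapCLM 2 (fun n => d n • ContinuousLinearMap.id ℂ ℂ) hK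
      (fun n => by simpa [norm_smul] using hd n) ∘L
    fourierBasis.repr.toContinuousLinearEquiv.toContinuousLinearMap

theorem repr_fourierMultiplier (d : ℤ → ℂ) {K : ℝ} (hK : 0 ≤ K) (hd : ∀ n, ‖d n‖ ≤ K) (f : L2)
    (n : ℤ) : fourierBasis.repr (fourierMultiplier d hK hd f) n = d n * fourierBasis.repr f n := by
  simp [fourierMultiplier]

theorem norm_fourierMultiplier_le (d : ℤ → ℂ) {K : ℝ} (hK : 0 ≤ K) (hd : ∀ n, ‖d n‖ ≤ K) :
    ‖fourierMultiplier d hK hd‖ ≤ K := by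
  refine ContinuousLinearMap.opNorm_le_bound _ hK fun f => ?_
  have := (lp.mapCLM 2 (fun n => d n • ContinuousLinearMap.id ℂ ℂ) hK
      (fun n => by simpa [norm_smul] using hd n)).le_of_opNorm_le
      (lp.norm_mapCLM_le _ _ _ _) (fourierBasis.repr f)
  simpa [fourierMultiplier] using this

theorem ext_repr {f g : L2} (h : ∀ n, fourierBasis.repr f n = fourierBasis.repr g n) : f = g :=
  fourierBasis.repr.injective (lp.ext (funext h))

theorem fourierMultiplier_symm (d : ℤ → ℝ) {K : ℝ} (hK : 0 ≤ K) (hd : ∀ n, ‖(d n : ℂ)‖ ≤ K)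
    (f g : L2) :
    inner ℂ (fourierMultiplier (fun n => (d n : ℂ)) hK hd f) g =
      inner ℂ f (fourierMultiplier (fun n => (d n : ℂ)) hK hd g) := by
  refine (hasSum_inner _ _).unique ?_
  convert hasSum_inner f (fourierMultiplier (fun n => (d n : ℂ)) hK hd g) using 1
  ext n
  rw [repr_fourierMultiplier, repr_fourierMultiplier, map_mul, Complex.conj_ofReal]
  ring

theorem isCompactOperator_fourierMultiplier_of_finite (s : Finset ℤ) (d : ℤ → ℂ) {K : ℝ}
    (hK : 0 ≤ K) (hd : ∀ n, ‖d n‖ ≤ K) (hs : ∀ n ∉ s, d n = 0) :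
    IsCompactOperator (fourierMultiplier d hK hd) := by
  have h : fourierMultiplier d hK hd = ∑ n ∈ s,
      (ContinuousLinearMap.toSpanSingleton ℂ (d n • fourierBasis n : L2)) ∘L
        (innerSL ℂ (fourierBasis n : L2)) := by
    ext1 f
    apply ext_repr
    intro m
    rw [repr_fourierMultiplier]
    simp only [sum_apply, map_sum, lp.coeFn_sum, Finset.sum_apply]
    simp only [ContinuousLinearMap.comp_apply, innerSL_apply_apply,
      ContinuousLinearMap.toSpanSingleton_apply, map_smul, lp.coeFn_smul, Pi.smul_apply,
      smul_eq_mul, HilbertBasis.repr_self]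
    simp only [← fourierBasis.repr_apply_apply, lp.single_apply]
    by_cases hm : m ∈ s
    · rw [Finset.sum_eq_single_of_mem m hm]
      · simp; ring
      · intro n _ hn
        simp [hn.symm]
    · rw [hs m hm, zero_mul, Finset.sum_eq_zero]
      intro n hn
      have : m ≠ n := fun h => hm (h ▸ hn)
      simp [this]
  rw [h]
  refine Submodule.sum_mem (compactOperator (RingHom.id ℂ) L2 L2) fun n _ => ?_
  exact IsCompactOperator.comp_clm (isCompactOperator_of_locallyCompactSpace_rng
    (ContinuousLinearMap.toSpanSingleton ℂ (d n • fourierBasis n : L2)))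
    (innerSL ℂ (fourierBasis n : L2))

/-- The symbol of `Λ^{-1/2}`. -/
def invSqrtAbs (n : ℤ) : ℝ := (√|(n : ℝ)|)⁻¹

theorem invSqrtAbs_nonneg (n : ℤ) : 0 ≤ invSqrtAbs n := by unfold invSqrtAbs; positivity

/-- The convention `0⁻¹ = 0` makes the symbol annihilate constants. -/
theorem invSqrtAbs_zero : invSqrtAbs 0 = 0 := by simp [invSqrtAbs]

theorem abs_mul_invSqrtAbs_sq {n : ℤ} (hn : n ≠ 0) : |(n : ℝ)| * invSqrtAbs n ^ 2 = 1 := by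
  have : |(n : ℝ)| ≠ 0 := by simpa using hn
  rw [invSqrtAbs, inv_pow, Real.sq_sqrt (abs_nonneg _), mul_inv_cancel₀ this]

theorem invSqrtAbs_le {N : ℕ} {n : ℤ} (hn : (N : ℝ) + 1 ≤ |(n : ℝ)|) :
    invSqrtAbs n ≤ (√((N : ℝ) + 1))⁻¹ := by
  unfold invSqrtAbs
  gcongr

theorem norm_invSqrtAbs_le_one (n : ℤ) : ‖(invSqrtAbs n : ℂ)‖ ≤ 1 := by
  rw [Complex.norm_real, Real.norm_of_nonneg (invSqrtAbs_nonneg n)]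
  by_cases hn : n = 0
  · rw [hn, invSqrtAbs_zero]; exact zero_le_one
  · have : (1 : ℤ) ≤ |n| := Int.one_le_abs hn
    have : ((0 : ℕ) : ℝ) + 1 ≤ |(n : ℝ)| := by
      rw [← Int.cast_abs]; push_cast; rw [zero_add]; exact_mod_cast this
    simpa using invSqrtAbs_le this

/-- The operator `Λ^{-1/2}`, extended by `0` on constants. -/
def dtnInvSqrt : L2 →L[ℂ] L2 :=
  fourierMultiplier (fun n => (invSqrtAbs n : ℂ)) zero_le_one norm_invSqrtAbs_le_one

theorem repr_dtnInvSqrt (f : L2) (n : ℤ) :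
    fourierBasis.repr (dtnInvSqrt f) n = invSqrtAbs n * fourierBasis.repr f n :=
  repr_fourierMultiplier _ _ _ _ _

theorem dtnInvSqrt_symm (f g : L2) : inner ℂ (dtnInvSqrt f) g = inner ℂ f (dtnInvSqrt g) :=
  fourierMultiplier_symm _ _ _ _ _

/-- Truncations to `|n| ≤ N` have finite rank and differ from the operator by at most `(N +
1)^{-1/2}` in norm. -/
theorem isCompactOperator_dtnInvSqrt : IsCompactOperator dtnInvSqrt := by
  classical
  let s : ℕ → Finset ℤ := fun N => Finset.Icc (-(N : ℤ)) N
  let d : ℕ → ℤ → ℂ := fun N n => if n ∈ s N then (invSqrtAbs n : ℂ) else 0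
  have hd : ∀ N n, ‖d N n‖ ≤ 1 := by
    intro N n
    by_cases h : n ∈ s N
    · simpa only [d, h, if_true] using norm_invSqrtAbs_le_one n
    · simp [d, h]
  refine isCompactOperator_of_tendsto (l := Filter.atTop)
    (F := fun N => fourierMultiplier (d N) zero_le_one (hd N)) ?_
    (Filter.Eventually.of_forall fun N =>
      isCompactOperator_fourierMultiplier_of_finite (s N) _ _ _ (fun n hn => by simp [d, hn]))
  rw [tendsto_iff_norm_sub_tendsto_zero]
  have hlim : Filter.Tendsto (fun N : ℕ => (√((N : ℝ) + 1))⁻¹) Filter.atTop (nhds 0) := by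
    refine Filter.Tendsto.inv_tendsto_atTop ?_
    exact Real.tendsto_sqrt_atTop.comp
      (Filter.tendsto_atTop_add_const_right _ _ tendsto_natCast_atTop_atTop)
  refine squeeze_zero (fun _ => norm_nonneg _) (fun N => ?_) hlim
  have hdiff : ∀ n, ‖d N n - (invSqrtAbs n : ℂ)‖ ≤ (√((N : ℝ) + 1))⁻¹ := by
    intro n
    by_cases h : n ∈ s N
    · simp only [d, h, if_true, sub_self, norm_zero]; positivity
    · simp only [d, h, if_false, zero_sub, norm_neg]
      rw [Complex.norm_real, Real.norm_of_nonneg (invSqrtAbs_nonneg n)]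
      refine invSqrtAbs_le ?_
      rw [Finset.mem_Icc, ← abs_le] at h
      have : (N : ℤ) + 1 ≤ |n| := by omega
      exact_mod_cast this
  have heq : fourierMultiplier (d N) zero_le_one (hd N) - dtnInvSqrt =
      fourierMultiplier (fun n => d N n - (invSqrtAbs n : ℂ)) (by positivity) hdiff := by
    ext1 f
    apply ext_repr
    intro n
    simp only [sub_apply, map_sub, lp.coeFn_sub, Pi.sub_apply,
      repr_fourierMultiplier, repr_dtnInvSqrt]
    ring
  rw [heq]
  exact norm_fourierMultiplier_le _ _ _

/-! ### Multiplication operators and elliptic regularity. -/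

/-- Multiplication by a continuous real function on `L²`. -/
def mulOp (ρ : S → ℝ) (hρ : Continuous ρ) : L2 →L[ℂ] L2 :=
  (ContinuousLinearMap.mul ℂ ℂ).holderL haarAddCircle ⊤ 2 2
    (ContinuousMap.toLp ⊤ haarAddCircle ℂ ⟨fun x => (ρ x : ℂ), Complex.continuous_ofReal.comp hρ⟩)

theorem coeFn_mulOp (ρ : S → ℝ) (hρ : Continuous ρ) (f : L2) :
    mulOp ρ hρ f =ᵐ[haarAddCircle] fun x => (ρ x : ℂ) * f x := by
  have h1 := (ContinuousLinearMap.mul ℂ ℂ).coeFn_holder (r := 2)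
    (ContinuousMap.toLp ⊤ haarAddCircle ℂ
      ⟨fun x : S => (ρ x : ℂ), Complex.continuous_ofReal.comp hρ⟩) f
  have h2 := ContinuousMap.coeFn_toLp (p := ⊤) (𝕜 := ℂ) (haarAddCircle (T := 2 * Real.pi))
    (⟨fun x : S => (ρ x : ℂ), Complex.continuous_ofReal.comp hρ⟩ : C(S, ℂ))
  filter_upwards [h1, h2] with x h1 h2
  refine h1.trans ?_
  rw [h2]
  rfl

theorem mulOp_symm (ρ : S → ℝ) (hρ : Continuous ρ) (f g : L2) :
    inner ℂ (mulOp ρ hρ f) g = inner ℂ f (mulOp ρ hρ g) := by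
  rw [L2.inner_def, L2.inner_def]
  refine integral_congr_ae ?_
  filter_upwards [coeFn_mulOp ρ hρ f, coeFn_mulOp ρ hρ g] with x hf hg
  rw [hf, hg]
  simp only [RCLike.inner_apply', map_mul, Complex.conj_ofReal]
  ring

theorem re_inner_mulOp_nonneg (ρ : S → ℝ) (hρ : Continuous ρ) (h0 : ∀ x, 0 ≤ ρ x) (f : L2) :
    0 ≤ (inner ℂ f (mulOp ρ hρ f)).re := by
  have hint := L2.integrable_inner (𝕜 := ℂ) f (mulOp ρ hρ f)
  rw [L2.inner_def]
  have := integral_re hint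
  change 0 ≤ RCLike.re (K := ℂ) _
  rw [← this]
  refine integral_nonneg_of_ae ?_
  filter_upwards [coeFn_mulOp ρ hρ f] with x hf
  rw [hf]
  have : starRingEnd ℂ (f x) * ((ρ x : ℂ) * f x) = ((ρ x * ‖f x‖ ^ 2 : ℝ) : ℂ) := by
    rw [mul_left_comm, ← Complex.normSq_eq_conj_mul_self, Complex.normSq_eq_norm_sq]
    push_cast
    rfl
  simp only [RCLike.inner_apply', this]
  change 0 ≤ (((ρ x * ‖f x‖ ^ 2 : ℝ)) : ℂ).re
  rw [Complex.ofReal_re]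
  have := h0 x
  positivity

theorem mulOp_toL2 (ρ : S → ℝ) (hρ : Continuous ρ) (u : S → ℂ) (hu : Continuous u) :
    mulOp ρ hρ (toL2 u hu) =
      toL2 (fun x => (ρ x : ℂ) * u x) ((Complex.continuous_ofReal.comp hρ).mul hu) := by
  apply Lp.ext
  filter_upwards [coeFn_mulOp ρ hρ (toL2 u hu), coeFn_toL2 u hu,
    coeFn_toL2 (fun x => (ρ x : ℂ) * u x) ((Complex.continuous_ofReal.comp hρ).mul hu)]
    with x h1 h2 h3
  rw [h1, h2, h3]

theorem fourierBasis_eq_toL2 (n : ℤ) :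
    (fourierBasis n : L2) = toL2 (fourier n) (map_continuous _) := by
  rw [coe_fourierBasis]
  rfl

/-- Multiplication is convolution of Fourier coefficients; the conjugate replaces index `n - m` by
`m - n`, `ρ` being real. -/
theorem hasSum_repr_mulOp (ρ : S → ℝ) (hρ : Continuous ρ) (f : L2) (n : ℤ) :
    HasSum (fun m => starRingEnd ℂ (fourierCoeff (fun x => (ρ x : ℂ)) (m - n)) *
      fourierBasis.repr f m) (fourierBasis.repr (mulOp ρ hρ f) n) := by
  rw [fourierBasis.repr_apply_apply, ← mulOp_symm]
  convert hasSum_inner (mulOp ρ hρ (fourierBasis n)) f using 1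
  ext m
  congr 2
  rw [fourierBasis_eq_toL2, mulOp_toL2, repr_toL2]
  unfold fourierCoeff
  congr 1
  ext x
  simp only [smul_eq_mul]
  rw [neg_sub, sub_eq_neg_add, fourier_add]
  ring

theorem norm_repr_le (f : L2) (n : ℤ) : ‖fourierBasis.repr f n‖ ≤ ‖f‖ := by
  have := lp.norm_apply_le_norm (p := 2) (by norm_num) (fourierBasis.repr f) n
  simpa using this

/-- Peetre's inequality: it distributes a polynomial weight over a convolution. -/
theorem one_add_abs_le (m n : ℤ) :
    1 + |(n : ℝ)| ≤ (1 + |((m - n : ℤ) : ℝ)|) * (1 + |(m : ℝ)|) := by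
  have h : |(n : ℝ)| ≤ |((m - n : ℤ) : ℝ)| + |(m : ℝ)| := by
    have := abs_sub_abs_le_abs_sub (n : ℝ) m
    rw [abs_sub_comm] at this
    push_cast
    linarith
  nlinarith [abs_nonneg ((m - n : ℤ) : ℝ), abs_nonneg (m : ℝ)]

/-- Multiplication by a smooth function preserves polynomial decay of Fourier coefficients. -/
theorem exists_decay_mulOp {ρ : S → ℝ} (hρ : IsSmooth ρ) (f : L2) (k : ℕ) {C : ℝ}
    (hC : ∀ n : ℤ, (1 + |(n : ℝ)|) ^ k * ‖fourierBasis.repr f n‖ ≤ C) :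
    ∃ D : ℝ, ∀ n : ℤ,
      (1 + |(n : ℝ)|) ^ k * ‖fourierBasis.repr (mulOp ρ hρ.continuous f) n‖ ≤ D := by
  set r := fourierCoeff (fun x => (ρ x : ℂ)) with hr
  have hs : Summable fun j : ℤ => (1 + |(j : ℝ)|) ^ k * ‖r j‖ :=
    hρ.ofReal.rapidDecay.summable_pow_mul k
  refine ⟨(∑' j : ℤ, (1 + |(j : ℝ)|) ^ k * ‖r j‖) * C, fun n => ?_⟩
  have hshift : HasSum (fun m : ℤ => (1 + |((m - n : ℤ) : ℝ)|) ^ k * ‖r (m - n)‖)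
      (∑' j : ℤ, (1 + |(j : ℝ)|) ^ k * ‖r j‖) :=
    (Equiv.hasSum_iff (Equiv.subRight n) (f := fun j : ℤ => (1 + |(j : ℝ)|) ^ k * ‖r j‖)).mpr
      hs.hasSum
  have h1 := (hasSum_repr_mulOp ρ hρ.continuous f n).mul_left (((1 + |(n : ℝ)|) ^ k : ℝ) : ℂ)
  have h2 : ‖(((1 + |(n : ℝ)|) ^ k : ℝ) : ℂ) * fourierBasis.repr (mulOp ρ hρ.continuous f) n‖ ≤
      (∑' j : ℤ, (1 + |(j : ℝ)|) ^ k * ‖r j‖) * C := by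
    refine h1.norm_le_of_bounded (hshift.mul_right C) fun m => ?_
    rw [norm_mul, norm_mul, Complex.norm_real, Real.norm_of_nonneg (by positivity),
      RCLike.norm_conj, mul_assoc]
    calc (1 + |(n : ℝ)|) ^ k * (‖r (m - n)‖ * ‖fourierBasis.repr f m‖)
        ≤ ((1 + |((m - n : ℤ) : ℝ)|) * (1 + |(m : ℝ)|)) ^ k *
          (‖r (m - n)‖ * ‖fourierBasis.repr f m‖) := by
          gcongr
          exact one_add_abs_le m n
      _ = (1 + |((m - n : ℤ) : ℝ)|) ^ k * (‖r (m - n)‖ *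
          ((1 + |(m : ℝ)|) ^ k * ‖fourierBasis.repr f m‖)) := by
          rw [mul_pow]; ring
      _ ≤ (1 + |((m - n : ℤ) : ℝ)|) ^ k * (‖r (m - n)‖ * C) := by
          gcongr
          exact hC m
  rwa [norm_mul, Complex.norm_real, Real.norm_of_nonneg (by positivity)] at h2

/-- Elliptic regularity for `Λ f = κ ρ (f - c)`. -/
theorem rapidDecay_repr {ρ : S → ℝ} (hρ : IsSmooth ρ) {f : L2} {c κ : ℂ}
    (h : ∀ n : ℤ, (|(n : ℝ)| : ℝ) * fourierBasis.repr f n =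
      κ * (fourierBasis.repr (mulOp ρ hρ.continuous f) n -
        c * fourierCoeff (fun x => (ρ x : ℂ)) n)) :
    RapidDecay (fourierBasis.repr f) := by
  intro k
  induction k with
  | zero => exact ⟨‖f‖, fun n => by simpa using norm_repr_le f n⟩
  | succ k ih =>
    obtain ⟨C, hC⟩ := ih
    obtain ⟨D, hD⟩ := exists_decay_mulOp hρ f k hC
    obtain ⟨C', hC'⟩ := hρ.ofReal.rapidDecay k
    refine ⟨C + ‖κ‖ * (D + ‖c‖ * C'), fun n => ?_⟩
    have h1 : |(n : ℝ)| * ‖fourierBasis.repr f n‖ ≤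
        ‖κ‖ * (‖fourierBasis.repr (mulOp ρ hρ.continuous f) n‖ +
          ‖c‖ * ‖fourierCoeff (fun x => (ρ x : ℂ)) n‖) := by
      have := congrArg norm (h n)
      rw [norm_mul, norm_mul, Complex.norm_real, Real.norm_of_nonneg (abs_nonneg _)] at this
      rw [this]
      gcongr
      exact (norm_sub_le _ _).trans (by rw [norm_mul])
    -- Bootstrap: multiplication by `ρ` keeps the decay of order `k`, and the factor `|n|` in the
    -- equation improves it to order `k + 1`.
    calc (1 + |(n : ℝ)|) ^ (k + 1) * ‖fourierBasis.repr f n‖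
        = (1 + |(n : ℝ)|) ^ k * ‖fourierBasis.repr f n‖ +
          (1 + |(n : ℝ)|) ^ k * (|(n : ℝ)| * ‖fourierBasis.repr f n‖) := by ring
      _ ≤ (1 + |(n : ℝ)|) ^ k * ‖fourierBasis.repr f n‖ +
          (1 + |(n : ℝ)|) ^ k * (‖κ‖ * (‖fourierBasis.repr (mulOp ρ hρ.continuous f) n‖ +
          ‖c‖ * ‖fourierCoeff (fun x => (ρ x : ℂ)) n‖)) := by gcongr
      _ = (1 + |(n : ℝ)|) ^ k * ‖fourierBasis.repr f n‖ +
          ‖κ‖ * ((1 + |(n : ℝ)|) ^ k * ‖fourierBasis.repr (mulOp ρ hρ.continuous f) n‖ +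
          ‖c‖ * ((1 + |(n : ℝ)|) ^ k * ‖fourierCoeff (fun x => (ρ x : ℂ)) n‖)) := by ring
      _ ≤ _ := by
          gcongr
          · exact hC n
          · exact hD n
          · exact hC' n

theorem dtn_sub_const {u : S → ℂ} (hu : IsSmooth u) (c : ℂ) (x : S) :
    dtn (fun y => u y - c) x = dtn u x := by
  unfold dtn
  refine tsum_congr fun n => ?_
  by_cases hn : n = 0
  · simp [hn]
  · have h1 : (fun y => u y - c) = u + (fun y => (-c) * fourier 0 y) := by
      ext y; simp [sub_eq_add_neg]
    have h2 : fourierCoeff (fun y : S => (-c) * fourier 0 y) n = 0 := by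
      rw [fourierCoeff.const_mul]
      have := congrFun (fourierCoeff_fourier (T := 2 * Real.pi) 0) n
      rw [Pi.single_eq_of_ne hn] at this
      rw [this, mul_zero]
    rw [h1, fourierCoeff.add (integrable_of_continuous hu.continuous)
      (integrable_of_continuous (by fun_prop)), Pi.add_apply, h2, add_zero]

theorem exists_smooth_solution {ρ : S → ℝ} (hρ : IsSmooth ρ) {f : L2} {c κ : ℂ}
    (h : ∀ n : ℤ, (|(n : ℝ)| : ℝ) * fourierBasis.repr f n =
      κ * (fourierBasis.repr (mulOp ρ hρ.continuous f) n -
        c * fourierCoeff (fun x => (ρ x : ℂ)) n)) :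
    ∃ (F : S → ℂ) (hF : IsSmooth F), toL2 F hF.continuous = f ∧
      ∀ x, dtn (fun y => F y - c) x = κ * (ρ x * (F x - c)) := by
  have hd := rapidDecay_repr hρ h
  have hF := hd.isSmooth_tsum
  have hcoef : ∀ n, fourierCoeff (fun x : S => ∑' m : ℤ, fourierBasis.repr f m * fourier m x) n =
      fourierBasis.repr f n := fourierCoeff_tsum hd.summable_norm
  set F : S → ℂ := fun x => ∑' m : ℤ, fourierBasis.repr f m * fourier m x with hFdef
  have hFf : toL2 F hF.continuous = f := ext_repr fun n => by rw [repr_toL2, hcoef]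
  refine ⟨F, hF, hFf, fun x => ?_⟩
  rw [dtn_sub_const hF]
  have hprod : IsSmooth fun x => (ρ x : ℂ) * F x := hρ.ofReal.mul hF
  have hs := ((hprod.hasSum_fourier x).sub
    ((hρ.ofReal.hasSum_fourier x).mul_left c)).mul_left κ
  have : κ * (ρ x * (F x - c)) = κ * (ρ x * F x - c * ρ x) := by ring
  rw [this, ← hs.tsum_eq]
  unfold dtn
  refine tsum_congr fun n => ?_
  have hn := h n
  rw [← hFf, mulOp_toL2, repr_toL2, repr_toL2] at hn
  rw [← Complex.ofReal_intCast, Int.cast_abs, hn]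
  ring

/-! ### The compact operator whose eigenvalues are inverse Steklov eigenvalues. -/

section Operator

variable {ρ : S → ℝ} (hρ : Continuous ρ)

/-- The density `ρ` as an element of `L²`. -/
def densityL2 : L2 := toL2 (fun x => (ρ x : ℂ)) (Complex.continuous_ofReal.comp hρ)

/-- The operator `f ↦ ρ (f - ∫ ρ f)`. -/
def centeredMulOp : L2 →L[ℂ] L2 :=
  mulOp ρ hρ - (ContinuousLinearMap.toSpanSingleton ℂ (densityL2 hρ)) ∘L
    (innerSL ℂ (densityL2 hρ))

theorem centeredMulOp_apply (f : L2) :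
    centeredMulOp hρ f = mulOp ρ hρ f - inner ℂ (densityL2 hρ) f • densityL2 hρ := by
  simp [centeredMulOp]

theorem centeredMulOp_symm (f g : L2) :
    inner ℂ (centeredMulOp hρ f) g = inner ℂ f (centeredMulOp hρ g) := by
  rw [centeredMulOp_apply, centeredMulOp_apply, inner_sub_left, inner_sub_right, mulOp_symm,
    inner_smul_left, inner_smul_right, inner_conj_symm]
  ring

/-- The constant function `1` in `L²`. -/
def oneL2 : L2 := toL2 (fun _ => 1) continuous_const

theorem oneL2_eq : oneL2 = fourierBasis 0 := by
  rw [fourierBasis_eq_toL2]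
  unfold oneL2
  congr 1
  ext x
  simp

theorem mulOp_oneL2 : mulOp ρ hρ oneL2 = densityL2 hρ := by
  unfold oneL2 densityL2
  rw [mulOp_toL2]
  congr 1
  ext x
  simp

/-- The compact operator `Λ^{-1/2} (f ↦ ρ (f - ∫ ρ f)) Λ^{-1/2}`. -/
def steklovOp : L2 →L[ℂ] L2 := dtnInvSqrt ∘L centeredMulOp hρ ∘L dtnInvSqrt

theorem steklovOp_apply (w : L2) :
    steklovOp hρ w = dtnInvSqrt (centeredMulOp hρ (dtnInvSqrt w)) := rfl

theorem isCompactOperator_steklovOp : IsCompactOperator (steklovOp hρ) :=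
  isCompactOperator_dtnInvSqrt.comp_clm (centeredMulOp hρ ∘L dtnInvSqrt)

theorem isSymmetric_steklovOp : (steklovOp hρ).IsSymmetric := by
  intro f g
  change inner ℂ (steklovOp hρ f) g = inner ℂ f (steklovOp hρ g)
  rw [steklovOp_apply, steklovOp_apply, dtnInvSqrt_symm, centeredMulOp_symm, dtnInvSqrt_symm]

theorem inner_oneL2_densityL2 (hmean : ∫ x, (ρ x : ℂ) ∂haarAddCircle = 1) :
    inner ℂ oneL2 (densityL2 hρ) = 1 := by
  unfold oneL2 densityL2
  rw [inner_toL2]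
  simpa using hmean

theorem inner_densityL2_oneL2 (hmean : ∫ x, (ρ x : ℂ) ∂haarAddCircle = 1) :
    inner ℂ (densityL2 hρ) oneL2 = 1 := by
  rw [← inner_conj_symm, inner_oneL2_densityL2 hρ hmean, map_one]

theorem centeredMulOp_oneL2 (hmean : ∫ x, (ρ x : ℂ) ∂haarAddCircle = 1) :
    centeredMulOp hρ oneL2 = 0 := by
  rw [centeredMulOp_apply, mulOp_oneL2, inner_densityL2_oneL2 hρ hmean, one_smul, sub_self]

theorem inner_oneL2_centeredMulOp (hmean : ∫ x, (ρ x : ℂ) ∂haarAddCircle = 1) (f : L2) :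
    inner ℂ oneL2 (centeredMulOp hρ f) = 0 := by
  rw [← centeredMulOp_symm, centeredMulOp_oneL2 hρ hmean, inner_zero_left]

/-- The form is a variance: with `c = ∫ ρ f` it equals `∫ ρ |f - c|²`. -/
theorem re_inner_centeredMulOp_nonneg (hmean : ∫ x, (ρ x : ℂ) ∂haarAddCircle = 1)
    (h0 : ∀ x, 0 ≤ ρ x) (f : L2) : 0 ≤ (inner ℂ f (centeredMulOp hρ f)).re := by
  set c : ℂ := inner ℂ (densityL2 hρ) f with hc
  have hker : inner ℂ (densityL2 hρ) (f - c • oneL2) = 0 := by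
    rw [inner_sub_right, inner_smul_right, inner_densityL2_oneL2 hρ hmean, ← hc]
    ring
  have h1 : centeredMulOp hρ f = mulOp ρ hρ (f - c • oneL2) := by
    have : centeredMulOp hρ f = centeredMulOp hρ (f - c • oneL2) := by
      rw [map_sub, map_smul, centeredMulOp_oneL2 hρ hmean, smul_zero, sub_zero]
    rw [this, centeredMulOp_apply, hker, zero_smul, sub_zero]
  have h2 : inner ℂ f (centeredMulOp hρ f) =
      inner ℂ (f - c • oneL2) (mulOp ρ hρ (f - c • oneL2)) := by
    rw [← h1, inner_sub_left, inner_smul_left, inner_oneL2_centeredMulOp hρ hmean]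
    ring
  rw [h2]
  exact re_inner_mulOp_nonneg ρ hρ h0 _

theorem re_inner_steklovOp_nonneg (hmean : ∫ x, (ρ x : ℂ) ∂haarAddCircle = 1)
    (h0 : ∀ x, 0 ≤ ρ x) (w : L2) : 0 ≤ (inner ℂ w (steklovOp hρ w)).re := by
  rw [steklovOp_apply, ← dtnInvSqrt_symm]
  exact re_inner_centeredMulOp_nonneg hρ hmean h0 _

end Operator

/-! ### From the compact operator to the eigenvalues of `Λ_a`. -/

/-- An eigenvector of the compact operator gives a smooth Steklov eigenfunction. -/
theorem exists_smooth_of_steklovOp_eq {ρ : S → ℝ} (hρ : IsSmooth ρ)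
    (hmean : ∫ x, (ρ x : ℂ) ∂haarAddCircle = 1) {w : L2} {κ : ℂ} (hκ : κ ≠ 0)
    (hw : steklovOp hρ.continuous w = κ • w) :
    ∃ (F : S → ℂ) (hF : IsSmooth F), toL2 F hF.continuous = dtnInvSqrt w ∧
      ∀ x, dtn (fun y => F y - inner ℂ (densityL2 hρ.continuous) (dtnInvSqrt w)) x =
        κ⁻¹ * (ρ x * (F x - inner ℂ (densityL2 hρ.continuous) (dtnInvSqrt w))) := by
  refine exists_smooth_solution hρ fun n => ?_
  have hB : fourierBasis.repr (mulOp ρ hρ.continuous (dtnInvSqrt w)) n -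
      inner ℂ (densityL2 hρ.continuous) (dtnInvSqrt w) * fourierCoeff (fun x => (ρ x : ℂ)) n =
      fourierBasis.repr (centeredMulOp hρ.continuous (dtnInvSqrt w)) n := by
    rw [centeredMulOp_apply, map_sub, map_smul, lp.coeFn_sub, lp.coeFn_smul, Pi.sub_apply,
      Pi.smul_apply, smul_eq_mul, densityL2, repr_toL2]
  rw [hB]
  -- At `n = 0`, where `Λ^{-1/2}` loses information, both sides vanish: the range of `B` is
  -- orthogonal to constants.
  by_cases hn : n = 0
  · have := inner_oneL2_centeredMulOp hρ.continuous hmean (dtnInvSqrt w)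
    rw [oneL2_eq, ← fourierBasis.repr_apply_apply] at this
    rw [hn, this]
    simp
  · have h1 : κ * fourierBasis.repr w n =
        invSqrtAbs n * fourierBasis.repr (centeredMulOp hρ.continuous (dtnInvSqrt w)) n := by
      rw [← repr_dtnInvSqrt, ← steklovOp_apply, hw, map_smul, lp.coeFn_smul, Pi.smul_apply,
        smul_eq_mul]
    have h2 : fourierBasis.repr w n = κ⁻¹ * (invSqrtAbs n *
        fourierBasis.repr (centeredMulOp hρ.continuous (dtnInvSqrt w)) n) := by
      rw [← h1, inv_mul_cancel_left₀ hκ]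
    have h3 : ((|(n : ℝ)| : ℝ) : ℂ) * (invSqrtAbs n : ℂ) ^ 2 = 1 := by
      exact_mod_cast abs_mul_invSqrtAbs_sq hn
    rw [repr_dtnInvSqrt, h2]
    linear_combination (κ⁻¹ *
      fourierBasis.repr (centeredMulOp hρ.continuous (dtnInvSqrt w)) n) * h3

/-- The substitution `u = a^{-1/2} v` turns the Steklov form `Λ v = μ a⁻¹ v` into `Λ_a u = μ u`. -/
theorem dtnWeighted_inv_sqrt_mul {a : S → ℝ} (hpos : ∀ x, 0 < a x) {v : S → ℂ} {μ : ℂ}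
    (hv : ∀ x, dtn v x = μ * (((a x)⁻¹ : ℝ) * v x)) (x : S) :
    dtnWeighted a (fun y => ((√(a y))⁻¹ : ℝ) * v y) x = μ * (((√(a x))⁻¹ : ℝ) * v x) := by
  have hne : ∀ y, (√(a y) : ℂ) ≠ 0 := fun y => by
    exact_mod_cast (Real.sqrt_pos.mpr (hpos y)).ne'
  have h1 : (fun y => (√(a y) : ℂ) * (((√(a y))⁻¹ : ℝ) * v y)) = v := by
    ext y
    have := hne y
    push_cast
    field_simp
  have h2 : (a x : ℂ) = (√(a x) : ℂ) ^ 2 := by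
    rw [← Complex.ofReal_pow, Real.sq_sqrt (hpos x).le]
  unfold dtnWeighted
  rw [h1, hv]
  push_cast
  rw [h2]
  have := hne x
  field_simp

theorem isSmooth_inv_sqrt_mul {a : S → ℝ} (ha : IsSmooth a) (hpos : ∀ x, 0 < a x) {v : S → ℂ}
    (hv : IsSmooth v) : IsSmooth fun y => (((√(a y))⁻¹ : ℝ) : ℂ) * v y :=
  ((ha.sqrt hpos).inv fun x => Real.sqrt_pos.mpr (hpos x)).ofReal.mul hv

theorem dtn_const (c : ℂ) (x : S) : dtn (fun _ => c) x = 0 := by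
  have h := dtn_sub_const (isSmooth_const c) c x
  rw [← h]
  simp [dtn, fourierCoeff]

theorem smul_oneL2 (c : ℂ) : c • oneL2 = toL2 (fun _ => c) continuous_const := by
  have : c • oneL2 = toL2 (fun x => c * (1 : ℂ)) continuous_const := rfl
  rw [this]
  congr 1
  ext x
  rw [mul_one]

section Weight

variable {a : S → ℝ} (ha : IsSmooth a) (hpos : ∀ x, 0 < a x)

/-- The Steklov operator of the density `a⁻¹`. -/
def weightOp : L2 →L[ℂ] L2 := steklovOp (ha.inv hpos).continuous

/-- The condition that the density `a⁻¹` have mean `1`. -/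
def HasUnitMass (a : S → ℝ) : Prop := ∫ x, (((a x)⁻¹ : ℝ) : ℂ) ∂haarAddCircle = 1

theorem const_mem_eigenspaceLE {a : S → ℝ} (ha : IsSmooth a) (hpos : ∀ x, 0 < a x)
    {t : ℝ} (ht : 0 ≤ t) (c : ℂ) :
    (fun y => (((√(a y))⁻¹ : ℝ) : ℂ) * c) ∈ eigenspaceLE a t := by
  refine Submodule.subset_span ⟨isSmooth_inv_sqrt_mul ha hpos (isSmooth_const c), 0, ht, ?_⟩
  intro x
  refine dtnWeighted_inv_sqrt_mul hpos (v := fun _ => c) (μ := ((0 : ℝ) : ℂ)) (fun y => ?_) x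
  rw [dtn_const]
  simp

theorem exists_eigenfunction (hm : HasUnitMass a) {κ : ℝ} (hκ : κ ≠ 0) {w : L2}
    (hw : weightOp ha hpos w = (κ : ℂ) • w) :
    ∃ (v : S → ℂ) (hv : IsSmooth v) (c : ℂ),
      dtnInvSqrt w = toL2 v hv.continuous + c • oneL2 ∧
      ∀ x, dtn v x = ((κ⁻¹ : ℝ) : ℂ) * (((a x)⁻¹ : ℝ) * v x) := by
  obtain ⟨F, hF, hFw, h⟩ := exists_smooth_of_steklovOp_eq (ha.inv hpos) hm
    (κ := (κ : ℂ)) (by exact_mod_cast hκ) hw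
  set c := inner ℂ (densityL2 (ha.inv hpos).continuous) (dtnInvSqrt w) with hc
  refine ⟨fun y => F y - c, hF.sub (isSmooth_const c), c, ?_, fun x => ?_⟩
  · rw [← hFw, smul_oneL2]
    have : ∀ (u v w : S → ℂ) (hu : Continuous u) (hv : Continuous v) (hw : Continuous w),
        (∀ x, u x = v x + w x) → toL2 u hu = toL2 v hv + toL2 w hw := by
      intro u v w hu hv hw h
      obtain rfl : u = fun x => v x + w x := funext h
      rfl
    exact this _ _ _ _ _ _ fun x => by ring
  · rw [h x, Complex.ofReal_inv κ]

theorem weightOp_eq_zero_of_const (hm : HasUnitMass a) {w : L2} {c : ℂ}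
    (h : dtnInvSqrt w = c • oneL2) : weightOp ha hpos w = 0 := by
  rw [weightOp, steklovOp_apply, h, map_smul, centeredMulOp_oneL2 _ hm, smul_zero, map_zero]

end Weight

/-- If the compact operator has norm larger than one, then there are two eigenvalues of `Λ_a`
smaller than one. -/
theorem exists_lt_one_two_le_rank {a : S → ℝ} (ha : IsSmooth a) (hpos : ∀ x, 0 < a x)
    (hm : HasUnitMass a) (hnorm : 1 < ‖weightOp ha hpos‖) :
    ∃ t : ℝ, t < 1 ∧ ((2 : ℕ) : Cardinal) ≤ Module.rank ℂ (eigenspaceLE a t) := by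
  set T := weightOp ha hpos with hT
  have hsymm : T.IsSymmetric := isSymmetric_steklovOp _
  have hcomp : IsCompactOperator T := isCompactOperator_steklovOp _
  have hne : ((‖T‖ : ℝ) : ℂ) ≠ 0 := by
    have : ‖T‖ ≠ 0 := by linarith
    exact_mod_cast this
  have hT0 : T ≠ 0 := by
    intro h
    rw [h, norm_zero] at hnorm
    linarith
  have : Nontrivial L2 := by
    by_contra hnt
    rw [not_nontrivial_iff_subsingleton] at hnt
    exact hT0 (ContinuousLinearMap.ext fun x => Subsingleton.elim _ _)
  have hnonneg : ∀ w, 0 ≤ (inner ℂ w (T w)).re :=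
    re_inner_steklovOp_nonneg _ hm fun x => (inv_pos.mpr (hpos x)).le
  -- For a symmetric operator the norm is the supremum of the absolute Rayleigh quotients. If
  -- neither `‖T‖` nor `-‖T‖` were in the spectrum, these quotients would stay below `‖T‖` by a
  -- fixed margin.
  have hspec : ((‖T‖ : ℝ) : ℂ) ∈ spectrum ℂ T ∨ -((‖T‖ : ℝ) : ℂ) ∈ spectrum ℂ T := by
    by_contra! h
    obtain ⟨h1, h2⟩ := h
    obtain ⟨ε, hε, hε'⟩ := T.abs_rayleighQuotient_le_of_norm_mem_resolventSet
      (by simpa [spectrum] using h1) (by simpa [spectrum] using h2)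
    have := ciSup_le hε'
    rw [← T.norm_eq_iSup_rayleighQuotient hsymm] at this
    linarith
  obtain ⟨w, hw0, hw⟩ : ∃ w : L2, w ≠ 0 ∧ T w = ((‖T‖ : ℝ) : ℂ) • w := by
    rcases hspec with h | h
    · rw [← hcomp.hasEigenvalue_iff_mem_spectrum hne] at h
      obtain ⟨w, hw⟩ := h.exists_hasEigenvector
      exact ⟨w, hw.2, hw.apply_eq_smul⟩
    -- The negative sign contradicts the nonnegativity of `T`.
    · rw [← hcomp.hasEigenvalue_iff_mem_spectrum (neg_ne_zero.mpr hne)] at h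
      obtain ⟨w, hw⟩ := h.exists_hasEigenvector
      exfalso
      have h1 : T w = -((‖T‖ : ℝ) : ℂ) • w := hw.apply_eq_smul
      have h2 := hnonneg w
      rw [h1, inner_smul_right, inner_self_eq_ofReal, ← Complex.ofReal_neg, ← Complex.ofReal_mul,
        Complex.ofReal_re] at h2
      have : 0 < ‖w‖ := norm_pos_iff.mpr hw.2
      have : 0 < ‖w‖ ^ 2 := by positivity
      nlinarith
  obtain ⟨v, hv, c, hvw, hdtn⟩ := exists_eigenfunction ha hpos hm (κ := ‖T‖) (by linarith) hw
  refine ⟨‖T‖⁻¹, inv_lt_one_of_one_lt₀ hnorm, ?_⟩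
  have hsq : ∀ y, (((√(a y))⁻¹ : ℝ) : ℂ) ≠ 0 := fun y => by
    exact_mod_cast (inv_pos.mpr (Real.sqrt_pos.mpr (hpos y))).ne'
  have hmem0 := const_mem_eigenspaceLE ha hpos (t := ‖T‖⁻¹) (by positivity) 1
  have hmem1 : (fun y => (((√(a y))⁻¹ : ℝ) : ℂ) * v y) ∈ eigenspaceLE a ‖T‖⁻¹ :=
    Submodule.subset_span ⟨isSmooth_inv_sqrt_mul ha hpos hv, ‖T‖⁻¹, le_rfl,
      dtnWeighted_inv_sqrt_mul hpos hdtn⟩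
  -- `T` kills every `w` with `Λ^{-1/2} w` constant, so `v` is not constant and is independent of
  -- the eigenfunction for eigenvalue `0`.
  have hvconst : ∀ d : ℂ, (∀ x, v x = d) → False := by
    intro d hd
    obtain rfl : v = fun _ => d := funext hd
    rw [← smul_oneL2, ← add_smul] at hvw
    have := weightOp_eq_zero_of_const ha hpos hm hvw
    rw [← hT, hw] at this
    exact hw0 ((smul_eq_zero.mp this).resolve_left hne)
  have hli : LinearIndependent ℂ
      ![(⟨_, hmem0⟩ : eigenspaceLE a ‖T‖⁻¹), ⟨_, hmem1⟩] := by
    rw [LinearIndependent.pair_iff]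
    intro s t h
    have h' : ∀ x, s + t * v x = 0 := by
      intro x
      have := congrFun (congrArg Subtype.val h) x
      simp only [Submodule.coe_add, Submodule.coe_smul, Pi.add_apply, Pi.smul_apply,
        smul_eq_mul, Pi.zero_apply, Submodule.coe_zero, mul_one] at this
      have h2 : (((√(a x))⁻¹ : ℝ) : ℂ) * (s + t * v x) = 0 := by linear_combination this
      exact (mul_eq_zero.mp h2).resolve_left (hsq x)
    have ht : t = 0 := by
      by_contra ht
      refine hvconst (-s / t) fun x => ?_
      rw [eq_div_iff ht]
      linear_combination h' x
    refine ⟨?_, ht⟩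
    have := h' 0
    rwa [ht, zero_mul, add_zero] at this
  have := hli.cardinal_le_rank
  simpa using this

theorem repr_eq_zero_of_dtnInvSqrt_eq_zero {h : L2} (h0 : dtnInvSqrt h = 0) {n : ℤ}
    (hn : n ≠ 0) : fourierBasis.repr h n = 0 := by
  have h1 := repr_dtnInvSqrt h n
  rw [h0, map_zero, lp.coeFn_zero, Pi.zero_apply] at h1
  refine (mul_eq_zero.mp h1.symm).resolve_left ?_
  have := abs_mul_invSqrtAbs_sq hn
  intro h2
  rw [Complex.ofReal_eq_zero.mp h2] at this
  norm_num at this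

theorem mulOp_injective {ρ : S → ℝ} (hρ : Continuous ρ) (hpos : ∀ x, 0 < ρ x) {f : L2}
    (h : mulOp ρ hρ f = 0) : f = 0 := by
  apply Lp.ext
  filter_upwards [coeFn_mulOp ρ hρ f, Lp.coeFn_zero ℂ 2 (haarAddCircle (T := 2 * Real.pi))]
    with x h1 h2
  rw [h, h2, Pi.zero_apply] at h1
  rw [h2, Pi.zero_apply]
  refine (mul_eq_zero.mp h1.symm).resolve_left ?_
  exact_mod_cast (hpos x).ne'

/-- `Λ^{-1/2}` kills only constants. As `T w` has no constant mode, it vanishes; then `B f`, with `f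
= Λ^{-1/2} w`, is constant and orthogonal to `1`, hence zero. Positivity of `ρ` makes `f` constant,
and `f` has no constant mode either. -/
theorem mem_span_oneL2_of_dtnInvSqrt_weightOp_eq_zero {a : S → ℝ} (ha : IsSmooth a)
    (hpos : ∀ x, 0 < a x) (hm : HasUnitMass a) {w : L2}
    (h : dtnInvSqrt (weightOp ha hpos w) = 0) : w ∈ Submodule.span ℂ {oneL2} := by
  have hspan : ∀ {g : L2}, (∀ n : ℤ, n ≠ 0 → fourierBasis.repr g n = 0) →
      g = fourierBasis.repr g 0 • oneL2 := by
    intro g hg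
    apply ext_repr
    intro n
    rw [map_smul, lp.coeFn_smul, Pi.smul_apply, smul_eq_mul, oneL2_eq, HilbertBasis.repr_self,
      lp.single_apply]
    by_cases hn : n = 0
    · subst hn; simp
    · rw [hg n hn]; simp [hn]
  have hTw : weightOp ha hpos w = 0 := by
    rw [hspan fun n hn => repr_eq_zero_of_dtnInvSqrt_eq_zero h hn, weightOp, steklovOp_apply,
      repr_dtnInvSqrt, invSqrtAbs_zero]
    simp
  set f := dtnInvSqrt w with hf
  have hB : centeredMulOp (ha.inv hpos).continuous f = 0 := by
    rw [hspan (g := centeredMulOp (ha.inv hpos).continuous f)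
      fun n hn => repr_eq_zero_of_dtnInvSqrt_eq_zero hTw hn,
      fourierBasis.repr_apply_apply, ← oneL2_eq, inner_oneL2_centeredMulOp _ hm, zero_smul]
  set c := inner ℂ (densityL2 (ha.inv hpos).continuous) f with hc
  have hfc : f = c • oneL2 := by
    rw [← sub_eq_zero]
    refine mulOp_injective (ha.inv hpos).continuous (fun x => inv_pos.mpr (hpos x)) ?_
    rw [map_sub, map_smul, mulOp_oneL2, ← hB, centeredMulOp_apply]
  have hc0 : c = 0 := by
    have h1 := repr_dtnInvSqrt w 0
    rw [invSqrtAbs_zero, ← hf, hfc, map_smul, lp.coeFn_smul, Pi.smul_apply, smul_eq_mul, oneL2_eq,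
      HilbertBasis.repr_self, lp.single_apply_self] at h1
    simpa using h1
  rw [hc0, zero_smul] at hfc
  rw [hspan fun n hn => repr_eq_zero_of_dtnInvSqrt_eq_zero hfc hn]
  exact Submodule.smul_mem _ _ (Submodule.mem_span_singleton_self _)

/-- The smooth function `a^{-1/2} v`. -/
def invSqrtMul {a : S → ℝ} (ha : IsSmooth a) (hpos : ∀ x, 0 < a x) {v : S → ℂ}
    (hv : IsSmooth v) : smoothFun :=
  ⟨fun y => ((√(a y))⁻¹ : ℝ) * v y, isSmooth_inv_sqrt_mul ha hpos hv⟩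

theorem sqrtMul_invSqrtMul {a : S → ℝ} (ha : IsSmooth a) (hpos : ∀ x, 0 < a x) {v : S → ℂ}
    (hv : IsSmooth v) :
    smoothToL2 (sqrtMul ha hpos (invSqrtMul ha hpos hv)) = toL2 v hv.continuous := by
  have : sqrtMul ha hpos (invSqrtMul ha hpos hv) = ⟨v, hv⟩ := by
    ext x
    change (√(a x) : ℂ) * (((√(a x))⁻¹ : ℝ) * v x) = v x
    have : (√(a x) : ℂ) ≠ 0 := by exact_mod_cast (Real.sqrt_pos.mpr (hpos x)).ne'
    push_cast
    field_simp
  rw [this]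
  rfl

theorem smoothEigenspaceLE_mono {a : S → ℝ} (ha : IsSmooth a) (hpos : ∀ x, 0 < a x) :
    Monotone (smoothEigenspaceLE ha hpos) := by
  intro s t hst
  refine iSup_le fun μ => ?_
  exact le_iSup (fun ν : {ν : ℝ // ν ≤ t} =>
    Module.End.eigenspace (dtnWeightedLin ha hpos) (ν.1 : ℂ)) ⟨μ.1, μ.2.trans hst⟩

theorem mem_smoothEigenspaceLE {a : S → ℝ} (ha : IsSmooth a) (hpos : ∀ x, 0 < a x) {v : S → ℂ}
    (hv : IsSmooth v) {μ : ℝ} (h : ∀ x, dtn v x = (μ : ℂ) * (((a x)⁻¹ : ℝ) * v x)) :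
    invSqrtMul ha hpos hv ∈ smoothEigenspaceLE ha hpos μ := by
  refine Submodule.mem_iSup_of_mem (⟨μ, le_rfl⟩ : {ν : ℝ // ν ≤ μ}) ?_
  refine Module.End.mem_eigenspace_iff.mpr ?_
  ext x
  exact dtnWeighted_inv_sqrt_mul hpos h x

/-- The eigenfunctions of `Λ_a` span an infinite-dimensional space. -/
theorem aleph0_le_rank_iSup {a : S → ℝ} (ha : IsSmooth a) (hpos : ∀ x, 0 < a x)
    (hm : HasUnitMass a) :
    Cardinal.aleph0 ≤
      Module.rank ℂ (⨆ t, smoothEigenspaceLE ha hpos t : Submodule ℂ smoothFun) := by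
  by_contra! hfin
  set E := (⨆ t, smoothEigenspaceLE ha hpos t : Submodule ℂ smoothFun) with hE
  have hfree : Module.Free ℂ E := Module.Free.of_divisionRing ℂ E
  have : FiniteDimensional ℂ E := Module.rank_lt_aleph0_iff.mp hfin
  set T := weightOp ha hpos with hT
  have hsymm : T.IsSymmetric := isSymmetric_steklovOp _
  have hcomp : IsCompactOperator T := isCompactOperator_steklovOp _
  let Y : Submodule ℂ L2 := E.map (smoothToL2 ∘ₗ sqrtMul ha hpos)
  have hY : ∀ {v : S → ℂ} (hv : IsSmooth v) {μ : ℝ},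
      (∀ x, dtn v x = (μ : ℂ) * (((a x)⁻¹ : ℝ) * v x)) → toL2 v hv.continuous ∈ Y := by
    intro v hv μ h
    refine ⟨_, ?_, sqrtMul_invSqrtMul ha hpos hv⟩
    exact (le_iSup (smoothEigenspaceLE ha hpos) μ) (mem_smoothEigenspaceLE ha hpos hv h)
  have hYone : ∀ c : ℂ, c • oneL2 ∈ Y := by
    intro c
    rw [smul_oneL2]
    refine hY (isSmooth_const c) (μ := 0) fun x => ?_
    rw [dtn_const]
    simp
  -- If the eigenfunctions spanned a finite-dimensional space, `P` would be closed. It contains all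
  -- eigenspaces of `T`, so by the spectral theorem it is everything. Then `Λ^{-1/2} T` would have
  -- finite rank and a finite-dimensional kernel, forcing `L²` to be finite-dimensional.
  let P : Submodule ℂ L2 := Y.comap (dtnInvSqrt ∘L T : L2 →L[ℂ] L2).toLinearMap
  have hPclosed : IsClosed (P : Set L2) :=
    (Submodule.closed_of_finiteDimensional Y).preimage (dtnInvSqrt ∘L T).continuous
  have hle : (⨆ κ, Module.End.eigenspace (T : Module.End ℂ L2) κ) ≤ P := by
    refine iSup_le fun κ w hw => ?_
    have hw' : T w = κ • w := Module.End.mem_eigenspace_iff.mp hw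
    change dtnInvSqrt (T w) ∈ Y
    by_cases hw0 : w = 0
    · rw [hw0, map_zero, map_zero]; exact Y.zero_mem
    by_cases hκ : κ = 0
    · rw [hw', hκ, zero_smul, map_zero]; exact Y.zero_mem
    have hreal := hsymm.conj_eigenvalue_eq_self
      (Module.End.hasEigenvalue_of_hasEigenvector ⟨hw, hw0⟩)
    obtain ⟨r, rfl⟩ := Complex.conj_eq_iff_real.mp hreal
    obtain ⟨v, hv, c, hvw, hdtn⟩ := exists_eigenfunction ha hpos hm (κ := r)
      (by exact_mod_cast hκ) hw'
    rw [hw', map_smul, hvw]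
    exact Y.smul_mem _ (Y.add_mem (hY hv hdtn) (hYone c))
  have htop : P = ⊤ := by
    have h1 := ContinuousLinearMap.orthogonalComplement_iSup_eigenspaces_eq_bot hcomp hsymm
    rw [← Submodule.topologicalClosure_eq_top_iff] at h1
    rw [eq_top_iff, ← h1]
    exact Submodule.topologicalClosure_minimal _ hle hPclosed
  have hrange : LinearMap.range (dtnInvSqrt ∘L T : L2 →L[ℂ] L2).toLinearMap ≤ Y := by
    rintro _ ⟨w, rfl⟩
    have : w ∈ P := htop ▸ Submodule.mem_top
    exact this
  have hker : LinearMap.ker (dtnInvSqrt ∘L T : L2 →L[ℂ] L2).toLinearMap ≤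
      Submodule.span ℂ {oneL2} := fun w hw =>
    mem_span_oneL2_of_dtnInvSqrt_weightOp_eq_zero ha hpos hm hw
  have hrank : Module.rank ℂ L2 < Cardinal.aleph0 := by
    rw [← LinearMap.rank_range_add_rank_ker (dtnInvSqrt ∘L T : L2 →L[ℂ] L2).toLinearMap]
    refine Cardinal.add_lt_aleph0 ?_ ?_
    · exact (Submodule.rank_mono hrange).trans_lt (Module.rank_lt_aleph0 ℂ Y)
    · exact (Submodule.rank_mono hker).trans_lt (Module.rank_lt_aleph0 ℂ _)
  exact absurd hrank (not_lt.mpr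
    (fourierBasis (T := 2 * Real.pi)).orthonormal.linearIndependent.aleph0_le_rank)

/-- Finitely many vectors of an increasing union already lie in one member. -/
theorem exists_le_rank_of_monotone {V : Type*} [AddCommGroup V] [Module ℂ V]
    {W : ℝ → Submodule ℂ V} (hW : Monotone W)
    (h : Cardinal.aleph0 ≤ Module.rank ℂ (⨆ t, W t : Submodule ℂ V)) (k : ℕ) :
    ∃ t : ℝ, (k : Cardinal) ≤ Module.rank ℂ (W t) := by
  obtain ⟨b, hb⟩ := Module.le_rank_iff.mp ((Cardinal.natCast_lt_aleph0 (n := k)).le.trans h)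
  have hmem : ∀ i, ∃ t, (b i : V) ∈ W t := fun i =>
    (Submodule.mem_iSup_of_directed _ hW.directed_le).mp (b i).2
  choose t ht using hmem
  obtain ⟨M, hM⟩ := (Set.finite_range t).bddAbove
  have hli : LinearIndependent ℂ fun i => (⟨b i, hW (hM ⟨i, rfl⟩) (ht i)⟩ : W M) :=
    LinearIndependent.of_comp (W M).subtype
      (hb.map' (Submodule.subtype _) (Submodule.ker_subtype _))
  exact ⟨M, Module.le_rank_iff.mpr ⟨_, hli⟩⟩

/-- There are arbitrarily many eigenvalues. -/
theorem exists_le_rank_eigenspaceLE {a : S → ℝ} (ha : IsSmooth a) (hpos : ∀ x, 0 < a x)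
    (hm : HasUnitMass a) (k : ℕ) :
    ∃ t : ℝ, (k : Cardinal) ≤ Module.rank ℂ (eigenspaceLE a t) := by
  obtain ⟨t, ht⟩ := exists_le_rank_of_monotone (smoothEigenspaceLE_mono ha hpos)
    (aleph0_le_rank_iSup ha hpos hm) k
  refine ⟨t, ht.trans_eq ?_⟩
  rw [eigenspaceLE_eq_map ha hpos]
  exact (Submodule.equivMapOfInjective smoothFun.subtype (Submodule.injective_subtype _)
    (smoothEigenspaceLE ha hpos t)).rank_eq

/-! ### Second derivatives of Dirichlet series. -/

/-- Weierstrass: locally uniform convergence of holomorphic functions passes to derivatives, used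
twice. -/
theorem hasSum_iteratedDeriv_two {F : ℕ → ℂ → ℂ} {u : ℕ → ℝ} (hu : Summable u)
    (hF : ∀ i, Differentiable ℂ (F i)) {U : Set ℂ} (hU : IsOpen U)
    (hle : ∀ i, ∀ w ∈ U, ‖F i w‖ ≤ u i) {z : ℂ} (hz : z ∈ U) :
    HasSum (fun i => iteratedDeriv 2 (F i) z) (iteratedDeriv 2 (fun w => ∑' i, F i w) z) := by
  have h0 := (tendstoUniformlyOn_tsum hu hle).tendstoLocallyUniformlyOn
  have h1 := h0.deriv (Filter.Eventually.of_forall fun s =>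
    DifferentiableOn.fun_sum fun i _ => (hF i).differentiableOn) hU
  have hd : ∀ s : Finset ℕ, deriv (fun w => ∑ i ∈ s, F i w) = fun w => ∑ i ∈ s, deriv (F i) w := by
    intro s
    ext w
    exact deriv_fun_sum fun i _ => (hF i).differentiableAt
  have hF' : ∀ i, Differentiable ℂ (deriv (F i)) := fun i => (hF i).deriv
  have h2 := h1.deriv (Filter.Eventually.of_forall fun s => by
    simp only [Function.comp_apply, hd]
    exact DifferentiableOn.fun_sum fun i _ => (hF' i).differentiableOn) hU
  have h3 := h2.tendsto_at hz
  rw [HasSum]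
  have hit : ∀ g : ℂ → ℂ, iteratedDeriv 2 g = deriv (deriv g) := fun g => by
    rw [iteratedDeriv_succ, iteratedDeriv_one]
  simp only [hit]
  rw [SummationFilter.unconditional_filter]
  refine h3.congr fun s => ?_
  simp only [Function.comp_apply, hd]
  exact deriv_fun_sum fun i _ => (hF' i).differentiableAt

theorem iteratedDeriv_two_cpow_neg {l : ℝ} (hl : 0 < l) (s : ℝ) :
    iteratedDeriv 2 (fun z : ℂ => (l : ℂ) ^ (-z)) s = ((Real.log l ^ 2 * l ^ (-s) : ℝ) : ℂ) := by
  have hl' : (l : ℂ) ≠ 0 := by exact_mod_cast hl.ne'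
  have h1 : ∀ (c : ℂ) (z : ℂ), HasDerivAt (fun z : ℂ => c * (l : ℂ) ^ (-z))
      (-Complex.log l * c * (l : ℂ) ^ (-z)) z := by
    intro c z
    have := ((hasDerivAt_id z).neg.const_cpow (c := (l : ℂ)) (Or.inl hl')).const_mul c
    refine this.congr_deriv ?_
    simp only [id, Pi.neg_apply]
    ring
  have h2 : deriv (fun z : ℂ => (l : ℂ) ^ (-z)) = fun z => -Complex.log l * (l : ℂ) ^ (-z) := by
    ext z
    have := (h1 1 z).deriv
    simpa using this
  rw [iteratedDeriv_succ, iteratedDeriv_one, h2, (h1 _ _).deriv]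
  push_cast
  rw [Complex.ofReal_cpow hl.le, Complex.ofReal_log hl.le]
  push_cast
  ring

theorem norm_cpow_neg {l : ℝ} (hl : 0 < l) (z : ℂ) : ‖(l : ℂ) ^ (-z)‖ = l ^ (-z.re) := by
  rw [Complex.norm_cpow_eq_rpow_re_of_pos hl, Complex.neg_re]

theorem pos_of_linear_le {l : ℕ → ℝ} {c : ℝ} (hc : 0 < c) (hl : ∀ k, c * (k + 1) ≤ l k) (k : ℕ) :
    0 < l k :=
  lt_of_lt_of_le (by positivity) (hl k)

theorem summable_rpow_neg {l : ℕ → ℝ} {c : ℝ} (hc : 0 < c) (hl : ∀ k, c * (k + 1) ≤ l k)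
    {s : ℝ} (hs : 1 < s) : Summable fun k => l k ^ (-s) := by
  have h1 : Summable fun k : ℕ => (((k + 1 : ℕ) : ℝ)) ^ (-s) :=
    (summable_nat_add_iff 1).mpr (Real.summable_nat_rpow.mpr (by linarith))
  refine Summable.of_nonneg_of_le (fun k => Real.rpow_nonneg (pos_of_linear_le hc hl k).le _)
    (fun k => ?_) (h1.mul_left (c ^ (-s)))
  rw [← Real.mul_rpow hc.le (by positivity)]
  refine Real.rpow_le_rpow_of_nonpos (by positivity) ?_ (by linarith)
  exact_mod_cast hl k

/-- The strip around `s` on which the series is dominated. -/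
def strip (s : ℝ) : Set ℂ := {z | (1 + s) / 2 < z.re ∧ z.re < s + 1}

theorem isOpen_strip (s : ℝ) : IsOpen (strip s) :=
  (isOpen_lt continuous_const Complex.continuous_re).inter
    (isOpen_lt Complex.continuous_re continuous_const)

theorem mem_strip {s : ℝ} (hs : 1 < s) : (s : ℂ) ∈ strip s :=
  ⟨by rw [Complex.ofReal_re]; linarith, by rw [Complex.ofReal_re]; linarith⟩

/-- Adding the values at both edges covers `l ≥ 1` and `l ≤ 1` at once; finitely many eigenvalues
may lie below `1`. -/
theorem norm_le_of_mem_strip {l s : ℝ} (hl : 0 < l) {z : ℂ} (hz : z ∈ strip s) :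
    ‖(l : ℂ) ^ (-z)‖ ≤ l ^ (-((1 + s) / 2)) + l ^ (-(s + 1)) := by
  rw [norm_cpow_neg hl]
  have h1 : 0 ≤ l ^ (-((1 + s) / 2)) := by positivity
  have h2 : 0 ≤ l ^ (-(s + 1)) := by positivity
  rcases le_total 1 l with h | h
  · have := Real.rpow_le_rpow_of_exponent_le h (neg_le_neg hz.1.le)
    linarith
  · have := Real.rpow_le_rpow_of_exponent_ge hl h (neg_le_neg hz.2.le)
    linarith

theorem differentiable_cpow_neg {l : ℝ} (hl : 0 < l) :
    Differentiable ℂ fun z : ℂ => (l : ℂ) ^ (-z) := by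
  have hl' : (l : ℂ) ≠ 0 := by exact_mod_cast hl.ne'
  exact differentiable_neg.const_cpow (Or.inl hl')

theorem summable_strip_bound {l : ℕ → ℝ} {c : ℝ} (hc : 0 < c) (hl : ∀ k, c * (k + 1) ≤ l k)
    {s : ℝ} (hs : 1 < s) : Summable fun k => l k ^ (-((1 + s) / 2)) + l k ^ (-(s + 1)) :=
  (summable_rpow_neg hc hl (by linarith)).add (summable_rpow_neg hc hl (by linarith))

theorem contDiffAt_series {l : ℕ → ℝ} {c : ℝ} (hc : 0 < c) (hl : ∀ k, c * (k + 1) ≤ l k)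
    {s : ℝ} (hs : 1 < s) :
    ContDiffAt ℂ 2 (fun z : ℂ => ∑' k, (l k : ℂ) ^ (-z)) s := by
  have h : DifferentiableOn ℂ (fun z : ℂ => ∑' k, (l k : ℂ) ^ (-z)) (strip s) :=
    Complex.differentiableOn_tsum_of_summable_norm (summable_strip_bound hc hl hs)
      (fun k => (differentiable_cpow_neg (pos_of_linear_le hc hl k)).differentiableOn)
      (isOpen_strip s) (fun k w hw => norm_le_of_mem_strip (pos_of_linear_le hc hl k) hw)
  exact (h.analyticAt ((isOpen_strip s).mem_nhds (mem_strip hs))).contDiffAt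

theorem hasSum_iteratedDeriv_two_series {l : ℕ → ℝ} {c : ℝ} (hc : 0 < c)
    (hl : ∀ k, c * (k + 1) ≤ l k) {s : ℝ} (hs : 1 < s) :
    HasSum (fun k => ((Real.log (l k) ^ 2 * l k ^ (-s) : ℝ) : ℂ))
      (iteratedDeriv 2 (fun z : ℂ => ∑' k, (l k : ℂ) ^ (-z)) s) := by
  have := hasSum_iteratedDeriv_two (summable_strip_bound hc hl hs)
    (fun k => differentiable_cpow_neg (pos_of_linear_le hc hl k))
    (isOpen_strip s) (fun k w hw => norm_le_of_mem_strip (pos_of_linear_le hc hl k) hw)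
    (mem_strip hs)
  refine this.congr_fun fun k => ?_
  exact (iteratedDeriv_two_cpow_neg (pos_of_linear_le hc hl k) s).symm

theorem exists_iteratedDeriv_two_pos {l : ℕ → ℝ} {c : ℝ} (hc : 0 < c)
    (hl : ∀ k, c * (k + 1) ≤ l k) (h0 : l 0 < 1) :
    ∃ s₀ : ℝ, 1 < s₀ ∧ ∀ s : ℝ, s₀ ≤ s →
      Summable (fun k : ℕ => (l k : ℂ) ^ (-(s : ℂ))) ∧
      0 < iteratedDeriv 2 (fun z : ℂ => (∑' k, (l k : ℂ) ^ (-z)) - 2 * riemannZeta z) (s : ℂ) := by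
  set N : ℕ → ℝ := fun k => (k : ℝ) + 1 with hN
  have hNl : ∀ k : ℕ, (1 : ℝ) * (k + 1) ≤ N k := fun k => by simp [hN]
  have hNpos := pos_of_linear_le one_pos hNl
  have hlpos := pos_of_linear_le hc hl
  have hreal : ∀ {m : ℕ → ℝ} {d : ℝ}, 0 < d → (∀ k : ℕ, d * (k + 1) ≤ m k) → ∀ {s : ℝ}, 1 < s →
      Summable fun k => Real.log (m k) ^ 2 * m k ^ (-s) := fun hd hm s hs =>
    Complex.summable_ofReal.mp (hasSum_iteratedDeriv_two_series hd hm hs).summable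
  -- As the bases `k + 1` are at least `1`, the value at `s = 2` bounds the Riemann series for all
  -- `s ≥ 2`.
  set Z : ℝ := ∑' k, Real.log (N k) ^ 2 * N k ^ (-(2 : ℝ)) with hZ
  have hlog : 0 < Real.log (l 0) ^ 2 := by
    exact sq_pos_of_neg (Real.log_neg (hlpos 0) h0)
  have hev : ∀ᶠ s : ℝ in Filter.atTop, 2 * Z < Real.log (l 0) ^ 2 * l 0 ^ (-s) := by
    have h1 : Filter.Tendsto (fun s : ℝ => (l 0)⁻¹ ^ s) Filter.atTop Filter.atTop :=
      tendsto_rpow_atTop_of_base_gt_one _ ((one_lt_inv₀ (hlpos 0)).mpr h0)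
    have h2 := (h1.const_mul_atTop hlog).eventually_gt_atTop (2 * Z)
    filter_upwards [h2] with s hs
    rwa [Real.rpow_neg (hlpos 0).le, ← Real.inv_rpow (hlpos 0).le]
  obtain ⟨s₁, hs₁⟩ := Filter.eventually_atTop.mp hev
  refine ⟨max 2 s₁, by linarith [le_max_left 2 s₁], fun s hs => ?_⟩
  have hs2 : 2 ≤ s := (le_max_left _ _).trans hs
  have hs1 : 1 < s := by linarith
  constructor
  · refine Summable.of_norm ?_
    have := summable_rpow_neg hc hl hs1
    refine this.congr fun k => ?_
    rw [norm_cpow_neg (hlpos k), Complex.ofReal_re]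
  · have hzeta : riemannZeta =ᶠ[nhds (s : ℂ)] fun z => ∑' k, (N k : ℂ) ^ (-z) := by
      filter_upwards [(isOpen_lt continuous_const Complex.continuous_re).mem_nhds
        (show (1 : ℝ) < (s : ℂ).re by simpa using hs1)] with z hz
      rw [zeta_eq_tsum_one_div_nat_add_one_cpow hz]
      refine tsum_congr fun k => ?_
      rw [Complex.cpow_neg, one_div]
      simp [hN]
    have hev2 : (fun z : ℂ => (∑' k, (l k : ℂ) ^ (-z)) - 2 * riemannZeta z) =ᶠ[nhds (s : ℂ)]
        fun z => (∑' k, (l k : ℂ) ^ (-z)) - 2 * ∑' k, (N k : ℂ) ^ (-z) := by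
      filter_upwards [hzeta] with z hz
      rw [hz]
    rw [hev2.iteratedDeriv_eq, iteratedDeriv_fun_sub (contDiffAt_series hc hl hs1)
      (contDiffAt_const.mul (contDiffAt_series one_pos hNl hs1)),
      iteratedDeriv_const_mul_field,
      ← (hasSum_iteratedDeriv_two_series hc hl hs1).tsum_eq,
      ← (hasSum_iteratedDeriv_two_series one_pos hNl hs1).tsum_eq,
      ← Complex.ofReal_tsum, ← Complex.ofReal_tsum]
    -- In the order on `ℂ`, positivity includes having zero imaginary part. The derivative has
    -- therefore been rewritten as the cast of a real expression.
    have key : 0 < (∑' k, Real.log (l k) ^ 2 * l k ^ (-s)) -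
        2 * ∑' k, Real.log (N k) ^ 2 * N k ^ (-s) := by
      have h1 : Real.log (l 0) ^ 2 * l 0 ^ (-s) ≤ ∑' k, Real.log (l k) ^ 2 * l k ^ (-s) :=
        (hreal hc hl hs1).le_tsum 0 fun k _ =>
          mul_nonneg (sq_nonneg _) (Real.rpow_nonneg (hlpos k).le _)
      have h2 : ∑' k, Real.log (N k) ^ 2 * N k ^ (-s) ≤ Z := by
        refine Summable.tsum_le_tsum (fun k => ?_) (hreal one_pos hNl hs1)
          (hreal one_pos hNl one_lt_two)
        refine mul_le_mul_of_nonneg_left ?_ (sq_nonneg _)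
        exact Real.rpow_le_rpow_of_exponent_le (by simp [hN]) (neg_le_neg hs2)
      have h3 := hs₁ s ((le_max_right _ _).trans hs)
      linarith
    exact_mod_cast key

/-! ### Bounds for the eigenvalues. -/

/-- The eigenvalues grow at least linearly. -/
theorem exists_linear_le_eigenvalue {a : S → ℝ} (ha : IsSmooth a) (hpos : ∀ x, 0 < a x)
    (hm : HasUnitMass a) :
    ∃ c : ℝ, 0 < c ∧ ∀ k : ℕ, c * (k + 1) ≤ eigenvalue a (k + 1) := by
  obtain ⟨x₀, -, hx₀⟩ := isCompact_univ.exists_isMinOn Set.univ_nonempty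
    (ha.continuous.continuousOn (s := Set.univ))
  have hmin : ∀ x, a x₀ ≤ a x := fun x => hx₀ (Set.mem_univ x)
  refine ⟨a x₀ / 2, half_pos (hpos x₀), fun k => ?_⟩
  -- The set must be shown nonempty, since an empty infimum would be `0`; this is where the
  -- existence of infinitely many eigenvalues enters.
  refine le_csInf (exists_le_rank_eigenspaceLE ha hpos hm _) fun t ht => ?_
  -- Nonzero frequencies come in pairs `±n`, whence `N = k / 2` and the factor `1/2` in the
  -- constant.
  have h1 := le_of_le_rank_eigenspaceLE ha hpos hmin (N := k / 2) (t := t)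
    (le_trans (Nat.cast_le.mpr (by omega : 2 * (k / 2) + 2 ≤ k + 1 + 1)) ht)
  have h2 : (k : ℝ) + 1 ≤ 2 * ((k / 2 : ℕ) + 1) := by
    exact_mod_cast (by omega : k + 1 ≤ 2 * (k / 2 + 1))
  have := hpos x₀
  nlinarith

theorem eigenvalue_one_lt_one {a : S → ℝ} (ha : IsSmooth a) (hpos : ∀ x, 0 < a x)
    (hm : HasUnitMass a) (hnorm : 1 < ‖weightOp ha hpos‖) : eigenvalue a 1 < 1 := by
  obtain ⟨t, ht, hrank⟩ := exists_lt_one_two_le_rank ha hpos hm hnorm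
  -- The infimum is bounded below by `0`, from the counting bound with `m = 0` and `N = 0`.
  refine lt_of_le_of_lt (csInf_le ⟨0, fun t ht => ?_⟩ hrank) ht
  have := le_of_le_rank_eigenspaceLE ha hpos (fun x => (hpos x).le) (N := 0) (t := t)
    (by simpa using ht)
  simpa using this

/-! ### Balancing a density by a Möbius map. -/

/-- The identification of `S` with the unit circle in `ℂ`. -/
def circlePoint (x : S) : ℂ := fourier 1 x

theorem continuous_circlePoint : Continuous circlePoint := map_continuous (fourier 1)

theorem norm_circlePoint (x : S) : ‖circlePoint x‖ = 1 := norm_fourier_apply 1 x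

theorem circlePoint_coe (θ : ℝ) : circlePoint (θ : S) = Complex.exp (Complex.I * θ) := by
  unfold circlePoint
  rw [fourier_coe_apply]
  congr 1
  have : (Real.pi : ℂ) ≠ 0 := by exact_mod_cast Real.pi_ne_zero
  push_cast
  field_simp

theorem integral_haar_eq (g : S → ℝ) :
    ∫ x, g x ∂haarAddCircle = (2 * Real.pi)⁻¹ * ∫ θ in (0 : ℝ)..(2 * Real.pi), g (θ : S) := by
  rw [integral_haarAddCircle, smul_eq_mul]
  congr 1
  have := AddCircle.intervalIntegral_preimage (2 * Real.pi) 0 g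
  rw [zero_add] at this
  exact this.symm

theorem integrable_of_continuous_real {g : S → ℝ} (hg : Continuous g) :
    Integrable g haarAddCircle :=
  hg.integrable_of_hasCompactSupport (HasCompactSupport.of_compactSpace g)

theorem one_sub_norm_le (p : ℂ) (x : S) : 1 - ‖p‖ ≤ ‖circlePoint x - p‖ := by
  have := norm_sub_norm_le (circlePoint x) p
  rwa [norm_circlePoint] at this

theorem norm_circlePoint_sub_le (p : ℂ) (x : S) : ‖circlePoint x - p‖ ≤ 1 + ‖p‖ := by
  have := norm_sub_le (circlePoint x) p
  rwa [norm_circlePoint] at this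

theorem normSq_circlePoint_sub_pos {p : ℂ} (hp : ‖p‖ < 1) (x : S) :
    0 < Complex.normSq (circlePoint x - p) := by
  rw [Complex.normSq_eq_norm_sq]
  have := one_sub_norm_le p x
  have : 0 < ‖circlePoint x - p‖ := by linarith
  positivity

/-- The function `x ↦ log |e^{ix} - p|²`. -/
def logDist (p : ℂ) (x : S) : ℝ := Real.log (Complex.normSq (circlePoint x - p))

theorem continuous_logDist {p : ℂ} (hp : ‖p‖ < 1) : Continuous (logDist p) :=
  (Complex.continuous_normSq.comp (continuous_circlePoint.sub continuous_const)).log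
    fun x => (normSq_circlePoint_sub_pos hp x).ne'

/-- The circle average of `log |z - p|` vanishes for `|p| < 1`, by Jensen's formula. -/
theorem integral_logDist {p : ℂ} (hp : ‖p‖ < 1) : ∫ x, logDist p x ∂haarAddCircle = 0 := by
  have h := circleAverage_log_norm_sub_const₀ hp
  rw [Real.circleAverage_def, smul_eq_mul] at h
  rw [integral_haar_eq]
  have : ∀ θ : ℝ, logDist p (θ : S) = 2 * Real.log ‖circleMap 0 1 θ - p‖ := by
    intro θ
    unfold logDist
    rw [circlePoint_coe, Complex.normSq_eq_norm_sq, Real.log_pow]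
    simp [circleMap, mul_comm]
  simp_rw [this]
  rw [intervalIntegral.integral_const_mul, mul_left_comm, h, mul_zero]

theorem logDist_le {p : ℂ} (hp : ‖p‖ < 1) (x : S) : logDist p x ≤ Real.log 4 := by
  refine Real.log_le_log (normSq_circlePoint_sub_pos hp x) ?_
  rw [Complex.normSq_eq_norm_sq]
  have := norm_circlePoint_sub_le p x
  have := norm_nonneg (circlePoint x - p)
  nlinarith

theorem le_logDist {p : ℂ} {r : ℝ} (hr : r < 1) (hp : ‖p‖ ≤ r) (x : S) :
    Real.log ((1 - r) ^ 2) ≤ logDist p x := by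
  refine Real.log_le_log (by have : 0 < 1 - r := by linarith
                             positivity) ?_
  rw [Complex.normSq_eq_norm_sq]
  have := one_sub_norm_le p x
  exact pow_le_pow_left₀ (by linarith) (by linarith) 2

section Balancing

variable {ρ : S → ℝ}

/-- The logarithmic potential of the density `ρ`. -/
def potential (ρ : S → ℝ) (p : ℂ) : ℝ := ∫ x, ρ x * logDist p x ∂haarAddCircle

/-- As `log 4 - logDist p` is nonnegative with mean `log 4`, its integral against `ρ ≤ M` is at most
`M log 4`. The bound is uniform in `p`, which yields coercivity in the minimization. -/
theorem potential_lower_bound (hρ : Continuous ρ) {M : ℝ} (hM : ∀ x, ρ x ≤ M)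
    (hmean : ∫ x, ρ x ∂haarAddCircle = 1) {p : ℂ} (hp : ‖p‖ < 1) :
    (1 - M) * Real.log 4 ≤ potential ρ p := by
  have hint : Integrable (fun x => ρ x * logDist p x) haarAddCircle :=
    integrable_of_continuous_real (hρ.mul (continuous_logDist hp))
  have hint2 : Integrable (fun x => ρ x * Real.log 4) haarAddCircle :=
    integrable_of_continuous_real (hρ.mul continuous_const)
  have hint3 : Integrable (fun x => M * logDist p x) haarAddCircle :=
    integrable_of_continuous_real (continuous_const.mul (continuous_logDist hp))
  have h : ∫ x, (M * logDist p x - M * Real.log 4) ∂haarAddCircle ≤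
      ∫ x, (ρ x * logDist p x - ρ x * Real.log 4) ∂haarAddCircle := by
    refine integral_mono (hint3.sub (integrable_const _)) (hint.sub hint2) fun x => ?_
    have h1 := logDist_le hp x
    have h2 := hM x
    simp only
    nlinarith
  have h4 : ∫ x, ρ x * Real.log 4 ∂haarAddCircle = Real.log 4 := by
    rw [integral_mul_const, hmean, one_mul]
  rw [integral_sub hint3 (integrable_const _), integral_sub hint hint2, integral_const_mul,
    integral_logDist hp, h4, integral_const, probReal_univ] at h
  unfold potential
  simp only [smul_eq_mul] at h
  linarith

theorem continuousOn_potential (hρ : Continuous ρ) {r : ℝ} (hr : r < 1) :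
    ContinuousOn (potential ρ) (Metric.closedBall 0 r) := by
  obtain ⟨M, hM⟩ := (isCompact_range hρ).isBounded.exists_norm_le
  have hball : ∀ p ∈ Metric.closedBall (0 : ℂ) r, ‖p‖ ≤ r := fun p hp => by simpa using hp
  refine continuousOn_of_dominated
    (bound := fun _ => M * (|Real.log 4| + |Real.log ((1 - r) ^ 2)|)) ?_ ?_ ?_ ?_
  · intro p hp
    exact (hρ.mul (continuous_logDist ((hball p hp).trans_lt hr))).aestronglyMeasurable
  · intro p hp
    refine Filter.Eventually.of_forall fun x => ?_
    rw [norm_mul]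
    have h1 := logDist_le ((hball p hp).trans_lt hr) x
    have h2 := le_logDist hr (hball p hp) x
    have h3 : ‖logDist p x‖ ≤ |Real.log 4| + |Real.log ((1 - r) ^ 2)| := by
      rw [Real.norm_eq_abs, abs_le]
      have := neg_abs_le (Real.log ((1 - r) ^ 2))
      have := le_abs_self (Real.log 4)
      have := abs_nonneg (Real.log 4)
      have := abs_nonneg (Real.log ((1 - r) ^ 2))
      constructor <;> linarith
    exact mul_le_mul (hM _ ⟨x, rfl⟩) h3 (norm_nonneg _) ((norm_nonneg _).trans (hM _ ⟨x, rfl⟩))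
  · exact integrable_const _
  · refine Filter.Eventually.of_forall fun x => ?_
    refine continuousOn_const.mul ?_
    refine ContinuousOn.log ?_ fun p hp =>
      (normSq_circlePoint_sub_pos ((hball p hp).trans_lt hr) x).ne'
    exact (Complex.continuous_normSq.comp (continuous_const.sub continuous_id)).continuousOn

theorem hasDerivAt_normSq_sub (w h : ℂ) (t : ℝ) :
    HasDerivAt (fun t : ℝ => Complex.normSq (w - t * h))
      (-2 * ((w - t * h) * starRingEnd ℂ h).re) t := by
  have h1 : ∀ t : ℝ, Complex.normSq (w - t * h) =
      (w.re - t * h.re) * (w.re - t * h.re) + (w.im - t * h.im) * (w.im - t * h.im) := by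
    intro t
    simp [Complex.normSq_apply]
  simp_rw [h1]
  have hre : HasDerivAt (fun t : ℝ => w.re - t * h.re) (-h.re) t := by
    simpa using ((hasDerivAt_id t).mul_const h.re).const_sub w.re
  have him : HasDerivAt (fun t : ℝ => w.im - t * h.im) (-h.im) t := by
    simpa using ((hasDerivAt_id t).mul_const h.im).const_sub w.im
  refine ((hre.mul hre).add (him.mul him)).congr_deriv ?_
  simp
  ring

theorem hasDerivAt_potential (hρ : Continuous ρ) {p : ℂ} (hp : ‖p‖ < 1) (h : ℂ) :
    HasDerivAt (fun t : ℝ => potential ρ (p + t * h))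
      (∫ x, ρ x * (-2 * ((circlePoint x - p) * starRingEnd ℂ h).re /
        Complex.normSq (circlePoint x - p)) ∂haarAddCircle) 0 := by
  obtain ⟨M, hM⟩ := (isCompact_range hρ).isBounded.exists_norm_le
  set r := (1 + ‖p‖) / 2 with hr
  have hr1 : r < 1 := by rw [hr]; linarith
  have hpr : ‖p‖ < r := by rw [hr]; linarith
  have hopen : {t : ℝ | ‖p + t * h‖ < r} ∈ nhds (0 : ℝ) := by
    refine IsOpen.mem_nhds (isOpen_lt (by fun_prop) continuous_const) ?_
    simpa using hpr
  have key := hasDerivAt_integral_of_dominated_loc_of_deriv_le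
    (μ := haarAddCircle (T := 2 * Real.pi)) (𝕜 := ℝ)
    (F := fun t x => ρ x * logDist (p + t * h) x)
    (F' := fun t x => ρ x * (-2 * ((circlePoint x - (p + t * h)) * starRingEnd ℂ h).re /
        Complex.normSq (circlePoint x - (p + t * h))))
    (x₀ := 0) (bound := fun _ => M * (2 * ‖h‖ / (1 - r))) hopen ?_ ?_ ?_ ?_ ?_ ?_
  · refine key.2.congr_deriv ?_
    simp
  · filter_upwards [hopen] with t ht
    exact (hρ.mul (continuous_logDist (lt_trans ht hr1))).aestronglyMeasurable
  · exact integrable_of_continuous_real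
      (hρ.mul (continuous_logDist (by simpa using hp)))
  · refine Continuous.aestronglyMeasurable (hρ.mul ?_)
    refine Continuous.div ?_ ?_ fun x =>
      (normSq_circlePoint_sub_pos (by simpa using hp) x).ne'
    · exact continuous_const.mul (Complex.continuous_re.comp
        ((continuous_circlePoint.sub continuous_const).mul continuous_const))
    · exact Complex.continuous_normSq.comp (continuous_circlePoint.sub continuous_const)
  · refine Filter.Eventually.of_forall fun x t ht => ?_
    have hdist : 1 - r ≤ ‖circlePoint x - (p + t * h)‖ :=
      le_trans (by linarith [show ‖p + t * h‖ < r from ht]) (one_sub_norm_le _ x)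
    have hr0 : 0 < 1 - r := by linarith
    have hpos : 0 < ‖circlePoint x - (p + t * h)‖ := hr0.trans_le hdist
    rw [norm_mul]
    refine mul_le_mul (hM _ ⟨x, rfl⟩) ?_ (norm_nonneg _) ((norm_nonneg _).trans (hM _ ⟨x, rfl⟩))
    rw [norm_div, norm_mul, Complex.normSq_eq_norm_sq, norm_pow, norm_norm, norm_neg,
      Real.norm_ofNat, div_le_div_iff₀ (by positivity) hr0]
    have h1 : ‖((circlePoint x - (p + t * h)) * starRingEnd ℂ h).re‖ ≤
        ‖circlePoint x - (p + t * h)‖ * ‖h‖ := by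
      have := Complex.abs_re_le_norm ((circlePoint x - (p + t * h)) * starRingEnd ℂ h)
      rwa [norm_mul, RCLike.norm_conj] at this
    calc 2 * ‖((circlePoint x - (p + t * h)) * starRingEnd ℂ h).re‖ * (1 - r)
        ≤ 2 * (‖circlePoint x - (p + t * h)‖ * ‖h‖) * ‖circlePoint x - (p + t * h)‖ := by
          gcongr
      _ = _ := by ring
  · exact integrable_const _
  · refine Filter.Eventually.of_forall fun x t ht => ?_
    refine HasDerivAt.const_mul _ ?_
    have h1 := (hasDerivAt_normSq_sub (circlePoint x - p) h t).log
      (by rw [sub_sub]; exact (normSq_circlePoint_sub_pos (lt_trans ht hr1) x).ne')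
    simp only [sub_sub] at h1
    exact h1

/-- Every positive density on the circle can be balanced by a conformal automorphism. -/
theorem exists_balanced (hρ : Continuous ρ) (hmean : ∫ x, ρ x ∂haarAddCircle = 1) :
    ∃ p : ℂ, ‖p‖ < 1 ∧ ∫ x, (ρ x : ℂ) *
      ((circlePoint x - p) / (1 - starRingEnd ℂ p * circlePoint x)) ∂haarAddCircle = 0 := by
  obtain ⟨M, hM⟩ := (isCompact_range hρ).isBounded.exists_norm_le
  have hM' : ∀ x, ρ x ≤ M := fun x => (le_abs_self _).trans (hM _ ⟨x, rfl⟩)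
  -- `F` is the average over `ρ` of the logarithms of inverse Poisson kernels; its critical points
  -- are the conformal barycenters of `ρ`.
  set F : ℂ → ℝ := fun p => potential ρ p - Real.log (1 - Complex.normSq p) with hF
  have hF0 : F 0 = 0 := by
    simp [hF, potential, logDist, Complex.normSq_eq_norm_sq, norm_circlePoint]
  -- The radius `r` is chosen with `-log (1 - r²) = K`. Then `F ≥ 1 > F 0` on the circle of radius
  -- `r`, and the minimum over the closed disk is interior.
  set K : ℝ := |(1 - M) * Real.log 4| + 1 with hK
  have hK0 : 0 < K := by positivity
  set r : ℝ := √(1 - Real.exp (-K)) with hr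
  have hexp : Real.exp (-K) < 1 := by simpa using hK0
  have hexp0 := Real.exp_pos (-K)
  have hrsq : r ^ 2 = 1 - Real.exp (-K) := Real.sq_sqrt (by linarith)
  have hr0 : 0 ≤ r := Real.sqrt_nonneg _
  have hr1 : r < 1 := by nlinarith
  have hcont : ContinuousOn F (Metric.closedBall 0 r) := by
    refine (continuousOn_potential hρ hr1).sub (ContinuousOn.log ?_ ?_)
    · exact (continuous_const.sub Complex.continuous_normSq).continuousOn
    · intro p hp
      have : ‖p‖ ≤ r := by simpa using hp
      rw [Complex.normSq_eq_norm_sq]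
      have := norm_nonneg p
      nlinarith
  obtain ⟨p, hp, hmin⟩ := (isCompact_closedBall (0 : ℂ) r).exists_isMinOn
    ⟨0, by simpa using hr0⟩ hcont
  have hpr : ‖p‖ ≤ r := by simpa using hp
  have hp1 : ‖p‖ < 1 := hpr.trans_lt hr1
  have hplt : ‖p‖ < r := by
    refine lt_of_le_of_ne hpr fun heq => ?_
    have h1 : F p ≤ 0 := hF0 ▸ hmin (by simpa using hr0 : (0 : ℂ) ∈ Metric.closedBall 0 r)
    have h2 := potential_lower_bound hρ hM' hmean hp1
    have h3 : Real.log (1 - Complex.normSq p) = -K := by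
      rw [Complex.normSq_eq_norm_sq, heq, hrsq, sub_sub_cancel, Real.log_exp]
    have h4 := neg_abs_le ((1 - M) * Real.log 4)
    simp only [hF, h3] at h1
    linarith
  have hq : 0 < 1 - Complex.normSq p := by
    rw [Complex.normSq_eq_norm_sq]
    have := norm_nonneg p
    nlinarith
  set Y : ℂ := ∫ x, (ρ x : ℂ) * ((circlePoint x - p) /
    (Complex.normSq (circlePoint x - p) : ℂ)) ∂haarAddCircle with hY
  have hYint : Integrable (fun x => (ρ x : ℂ) * ((circlePoint x - p) /
    (Complex.normSq (circlePoint x - p) : ℂ))) haarAddCircle := by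
    refine integrable_of_continuous ((Complex.continuous_ofReal.comp hρ).mul ?_)
    refine Continuous.div (continuous_circlePoint.sub continuous_const) ?_ fun x => ?_
    · exact Complex.continuous_ofReal.comp
        (Complex.continuous_normSq.comp (continuous_circlePoint.sub continuous_const))
    · exact_mod_cast (normSq_circlePoint_sub_pos hp1 x).ne'
  -- The gradient of `F` vanishes at `p`; the directions `1` and `I` then give `Y` itself.
  have hcrit : ∀ h : ℂ, (Y * starRingEnd ℂ h).re =
      (p * starRingEnd ℂ h).re / (1 - Complex.normSq p) := by
    intro h
    have hd1 := hasDerivAt_potential hρ hp1 h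
    have hd2 : HasDerivAt (fun t : ℝ => Real.log (1 - Complex.normSq (p + t * h)))
        (-(2 * (p * starRingEnd ℂ h).re) / (1 - Complex.normSq p)) 0 := by
      have h1 := (hasDerivAt_normSq_sub p (-h) 0).const_sub 1
      have h2 := h1.log (by simpa using hq.ne')
      simp only [mul_neg, sub_neg_eq_add, Complex.ofReal_zero, zero_mul, add_zero,
        map_neg, Complex.neg_re] at h2
      refine h2.congr_deriv ?_
      ring
    have hd := hd1.sub hd2
    have hloc : IsLocalMin ((fun t : ℝ => potential ρ (p + t * h)) -
        fun t : ℝ => Real.log (1 - Complex.normSq (p + t * h))) 0 := by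
      have hnear : ∀ᶠ t : ℝ in nhds 0, ‖p + t * h‖ < r := by
        refine IsOpen.mem_nhds (isOpen_lt (by fun_prop) continuous_const) ?_
        simpa using hplt
      filter_upwards [hnear] with t ht
      have := hmin (by simpa using ht.le : p + t * h ∈ Metric.closedBall 0 r)
      simpa [hF] using this
    have hzero := hloc.hasDerivAt_eq_zero hd
    have hI : ∫ x, ρ x * (-2 * ((circlePoint x - p) * starRingEnd ℂ h).re /
        Complex.normSq (circlePoint x - p)) ∂haarAddCircle = -2 * (Y * starRingEnd ℂ h).re := by
      have h1 : (Y * starRingEnd ℂ h).re = ∫ x, ((ρ x : ℂ) * ((circlePoint x - p) /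
          (Complex.normSq (circlePoint x - p) : ℂ)) * starRingEnd ℂ h).re ∂haarAddCircle := by
        rw [hY, ← integral_mul_const]
        exact (integral_re (𝕜 := ℂ) (hYint.mul_const _)).symm
      rw [h1, ← integral_const_mul]
      congr 1
      ext x
      have : (ρ x : ℂ) * ((circlePoint x - p) / (Complex.normSq (circlePoint x - p) : ℂ)) *
          starRingEnd ℂ h = ((ρ x / Complex.normSq (circlePoint x - p) : ℝ) : ℂ) *
          ((circlePoint x - p) * starRingEnd ℂ h) := by
        push_cast; ring
      rw [this, Complex.re_ofReal_mul]
      ring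
    rw [hI, sub_eq_zero] at hzero
    rw [eq_div_iff hq.ne']
    rw [eq_div_iff hq.ne'] at hzero
    linarith
  have hYeq : Y = p / ((1 - Complex.normSq p : ℝ) : ℂ) := by
    apply Complex.ext
    · have := hcrit 1
      rw [Complex.div_ofReal_re]
      simpa using this
    · have := hcrit Complex.I
      rw [Complex.div_ofReal_im]
      simpa using this
  refine ⟨p, hp1, ?_⟩
  have hqC : ((1 - Complex.normSq p : ℝ) : ℂ) ≠ 0 := by exact_mod_cast hq.ne'
  -- On the unit circle `1 - p̄ z = z · conj (z - p)`, which reduces the Möbius integrand to that of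
  -- `Y` plus a constant multiple of `ρ`.
  have hpoint : ∀ x, (ρ x : ℂ) * ((circlePoint x - p) / (1 - starRingEnd ℂ p * circlePoint x)) =
      ((1 - Complex.normSq p : ℝ) : ℂ) * ((ρ x : ℂ) * ((circlePoint x - p) /
        (Complex.normSq (circlePoint x - p) : ℂ))) - (ρ x : ℂ) * p := by
    intro x
    have hz : circlePoint x * starRingEnd ℂ (circlePoint x) = 1 := by
      rw [Complex.mul_conj, Complex.normSq_eq_norm_sq, norm_circlePoint]; simp
    have hne : (Complex.normSq (circlePoint x - p) : ℂ) ≠ 0 := by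
      exact_mod_cast (normSq_circlePoint_sub_pos hp1 x).ne'
    have hns : (Complex.normSq (circlePoint x - p) : ℂ) =
        (circlePoint x - p) * (starRingEnd ℂ (circlePoint x) - starRingEnd ℂ p) := by
      rw [← map_sub, Complex.mul_conj]
    have hnp : ((1 - Complex.normSq p : ℝ) : ℂ) = 1 - p * starRingEnd ℂ p := by
      rw [Complex.mul_conj]; push_cast; rfl
    have hne1 : circlePoint x - p ≠ 0 := fun h => hne (by rw [hns, h, zero_mul])
    have hne2 : starRingEnd ℂ (circlePoint x) - starRingEnd ℂ p ≠ 0 :=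
      fun h => hne (by rw [hns, h, mul_zero])
    have hfac : 1 - starRingEnd ℂ p * circlePoint x =
        circlePoint x * (starRingEnd ℂ (circlePoint x) - starRingEnd ℂ p) := by
      linear_combination -hz
    have hzne : circlePoint x ≠ 0 := fun h => by rw [h, zero_mul] at hz; exact zero_ne_one hz
    rw [hns, hnp, hfac]
    field_simp
    linear_combination ((ρ x : ℂ) * p) * hz
  simp_rw [hpoint]
  have hρint : Integrable (fun x => (ρ x : ℂ) * p) haarAddCircle :=
    integrable_of_continuous ((Complex.continuous_ofReal.comp hρ).mul continuous_const)
  rw [integral_sub (hYint.const_mul _) hρint, integral_const_mul, integral_mul_const, ← hY, hYeq,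
    integral_complex_ofReal, hmean, mul_div_cancel₀ _ hqC]
  simp

end Balancing

/-! ### The Rayleigh quotient of a balanced test function. -/

/-- The test vector `Λ^{1/2} v` for the Rayleigh quotient. -/
theorem exists_dtnSqrt {v : S → ℂ} (hv : Continuous v) {E : ℝ}
    (hE : HasSum (fun n : ℤ => |(n : ℝ)| * ‖fourierCoeff v n‖ ^ 2) E) :
    ∃ w : L2, ‖w‖ ^ 2 = E ∧ dtnInvSqrt w = toL2 v hv - fourierCoeff v 0 • oneL2 := by
  have hterm : ∀ n : ℤ, ‖((√|(n : ℝ)| : ℝ) : ℂ) * fourierCoeff v n‖ ^ 2 =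
      |(n : ℝ)| * ‖fourierCoeff v n‖ ^ 2 := by
    intro n
    rw [norm_mul, mul_pow, Complex.norm_real, Real.norm_of_nonneg (Real.sqrt_nonneg _),
      Real.sq_sqrt (abs_nonneg _)]
  have hmem : Memℓp (fun n : ℤ => ((√|(n : ℝ)| : ℝ) : ℂ) * fourierCoeff v n) 2 := by
    refine memℓp_gen ?_
    have := hE.summable
    refine this.congr fun n => ?_
    rw [← hterm]
    norm_num
  let f : lp (fun _ : ℤ => ℂ) 2 := ⟨_, hmem⟩
  refine ⟨fourierBasis.repr.symm f, ?_, ext_repr fun n => ?_⟩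
  · rw [LinearIsometryEquiv.norm_map]
    have h1 := lp.hasSum_norm (p := 2) (by norm_num) f
    norm_num at h1
    refine h1.unique ?_
    convert hE using 1
    ext n
    exact hterm n
  · rw [repr_dtnInvSqrt, LinearIsometryEquiv.apply_symm_apply, map_sub, map_smul, lp.coeFn_sub,
      lp.coeFn_smul, Pi.sub_apply, Pi.smul_apply, smul_eq_mul, repr_toL2, oneL2_eq,
      HilbertBasis.repr_self, lp.single_apply]
    change _ * (((√|(n : ℝ)| : ℝ) : ℂ) * fourierCoeff v n) = _
    by_cases hn : n = 0
    · subst hn; simp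
    · have h0 : √|(n : ℝ)| ≠ 0 := (Real.sqrt_pos.mpr (by simpa using hn)).ne'
      have : ((invSqrtAbs n : ℝ) : ℂ) * ((√|(n : ℝ)| : ℝ) : ℂ) = 1 := by
        rw [← Complex.ofReal_mul, invSqrtAbs, inv_mul_cancel₀ h0, Complex.ofReal_one]
      rw [← mul_assoc, this]
      simp [hn]

theorem toL2_injective {u v : S → ℂ} {hu : Continuous u} {hv : Continuous v}
    (h : toL2 u hu = toL2 v hv) (x : S) : u x = v x := by
  have h1 : toL2 (fun y => u y - v y) (hu.sub hv) = 0 := by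
    have : toL2 (fun y => u y - v y) (hu.sub hv) = toL2 u hu - toL2 v hv := rfl
    rw [this, h, sub_self]
  exact sub_eq_zero.mp (toL2_eq_zero h1 x)

/-- A balanced unimodular test function of unit energy shows that the norm of the compact operator
is at least one, and in the case of equality it is an eigenfunction. -/
theorem one_lt_norm_or_dtn_eq {a : S → ℝ} (ha : IsSmooth a) (hpos : ∀ x, 0 < a x)
    (hm : HasUnitMass a) {v : S → ℂ} (hv : IsSmooth v) (hv1 : ∀ x, ‖v x‖ = 1)
    (hE : HasSum (fun n : ℤ => |(n : ℝ)| * ‖fourierCoeff v n‖ ^ 2) 1)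
    (hbal : ∫ x, (((a x)⁻¹ : ℝ) : ℂ) * v x ∂haarAddCircle = 0) :
    1 < ‖weightOp ha hpos‖ ∨ ∀ x, dtn v x = ((a x)⁻¹ : ℝ) * v x := by
  obtain ⟨w, hw, hGw⟩ := exists_dtnSqrt hv.continuous hE
  have hρ := (ha.inv hpos).continuous
  set V := toL2 v hv.continuous with hV
  have hbal' : inner ℂ (densityL2 hρ) V = 0 := by
    rw [densityL2, hV, inner_toL2, ← hbal]
    congr 1
    ext x
    rw [Complex.conj_ofReal, mul_comm]
  have hBG : centeredMulOp hρ (dtnInvSqrt w) = mulOp _ hρ V := by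
    rw [hGw, map_sub, map_smul, centeredMulOp_oneL2 hρ hm, smul_zero, sub_zero,
      centeredMulOp_apply, hbal', zero_smul, sub_zero]
  have hVV : inner ℂ V (mulOp _ hρ V) = 1 := by
    rw [hV, mulOp_toL2, inner_toL2, ← hm]
    congr 1
    ext x
    rw [mul_assoc, Complex.mul_conj, Complex.normSq_eq_norm_sq, hv1]
    simp
  have hwT : inner ℂ w (weightOp ha hpos w) = 1 := by
    rw [weightOp, steklovOp_apply, ← dtnInvSqrt_symm, hBG, hGw, inner_sub_left, inner_smul_left,
      hVV, ← mulOp_symm, mulOp_oneL2, hbal', mul_zero, sub_zero]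
  have hw1 : ‖w‖ = 1 := by
    have := norm_nonneg w
    nlinarith
  by_cases hT : 1 < ‖weightOp ha hpos‖
  · exact Or.inl hT
  right
  have hTw : ‖weightOp ha hpos w‖ ≤ 1 := by
    have := (weightOp ha hpos).le_opNorm w
    rw [hw1, mul_one] at this
    linarith
  have heq : weightOp ha hpos w = (1 : ℂ) • w := by
    rw [one_smul]
    -- Expanding the square gives `1 - 2 + ‖T w‖²`, which is at most `0` once `‖T w‖ ≤ 1`.
    have h1 : ‖w - weightOp ha hpos w‖ ^ 2 ≤ 0 := by
      rw [@norm_sub_sq ℂ, hwT, hw]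
      have := norm_nonneg (weightOp ha hpos w)
      rw [RCLike.one_re]
      nlinarith
    have h2 : ‖w - weightOp ha hpos w‖ = 0 := by
      have := norm_nonneg (w - weightOp ha hpos w)
      nlinarith
    exact (sub_eq_zero.mp (norm_eq_zero.mp h2)).symm
  obtain ⟨F, hF, hFw, h⟩ := exists_smooth_of_steklovOp_eq (ha.inv hpos) hm one_ne_zero heq
  have hc : inner ℂ (densityL2 hρ) (dtnInvSqrt w) = -fourierCoeff v 0 := by
    rw [hGw, inner_sub_right, inner_smul_right, hbal', inner_densityL2_oneL2 hρ hm]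
    ring
  have hFv : ∀ x, F x = v x - fourierCoeff v 0 := by
    refine toL2_injective (hu := hF.continuous) (hv := hv.continuous.sub continuous_const) ?_
    rw [hFw, hGw, smul_oneL2]
    rfl
  intro x
  have hx := h x
  rw [hc] at hx
  simpa [hFv] using hx

/-! ### The Möbius test function. -/

/-- The boundary values of the conformal automorphism of the disk which sends `p` to `0`. -/
def moebiusTrace (p : ℂ) (x : S) : ℂ :=
  (circlePoint x - p) / (1 - starRingEnd ℂ p * circlePoint x)

/-- The Fourier coefficients of `moebiusTrace p`. -/
def moebiusCoeff (p : ℂ) : ℤ → ℂ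
  | Int.ofNat 0 => -p
  | Int.ofNat (k + 1) => ((1 - ‖p‖ ^ 2 : ℝ) : ℂ) * starRingEnd ℂ p ^ k
  | Int.negSucc _ => 0

theorem moebiusCoeff_natCast_succ (p : ℂ) (k : ℕ) :
    moebiusCoeff p ((k + 1 : ℕ) : ℤ) = ((1 - ‖p‖ ^ 2 : ℝ) : ℂ) * starRingEnd ℂ p ^ k := rfl

theorem moebiusCoeff_of_notMem_range (p : ℂ) (n : ℤ) (hn : n ∉ Set.range ((↑) : ℕ → ℤ)) :
    moebiusCoeff p n = 0 := by
  rcases n with n | n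
  · exact absurd ⟨n, rfl⟩ hn
  · rfl

theorem hasSum_int_of_succ {A : Type*} [AddCommGroup A] [TopologicalSpace A]
    [IsTopologicalAddGroup A] {f : ℤ → A} (hf : ∀ n ∉ Set.range ((↑) : ℕ → ℤ), f n = 0)
    {s : A} (h : HasSum (fun k : ℕ => f ((k + 1 : ℕ) : ℤ)) s) : HasSum f (s + f 0) := by
  rw [← Function.Injective.hasSum_iff Nat.cast_injective hf]
  refine (hasSum_nat_add_iff' 1).mp ?_
  simpa using h

theorem norm_conj_mul_circlePoint_lt {p : ℂ} (hp : ‖p‖ < 1) (x : S) :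
    ‖starRingEnd ℂ p * circlePoint x‖ < 1 := by
  rw [norm_mul, RCLike.norm_conj, norm_circlePoint, mul_one]
  exact hp

theorem one_sub_conj_mul_ne_zero {p : ℂ} (hp : ‖p‖ < 1) (x : S) :
    1 - starRingEnd ℂ p * circlePoint x ≠ 0 := by
  intro h
  have := norm_conj_mul_circlePoint_lt hp x
  rw [← sub_eq_zero.mp h, norm_one] at this
  exact lt_irrefl _ this

theorem fourier_natCast (k : ℕ) (x : S) : fourier (k : ℤ) x = circlePoint x ^ k := by
  induction k with
  | zero => simp
  | succ k ih =>
    rw [Nat.cast_succ, fourier_add, ih, pow_succ]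
    rfl

theorem ofReal_one_sub_norm_sq (p : ℂ) :
    ((1 - ‖p‖ ^ 2 : ℝ) : ℂ) = 1 - starRingEnd ℂ p * p := by
  rw [← Complex.normSq_eq_conj_mul_self, Complex.normSq_eq_norm_sq]
  push_cast
  rfl

/-- Geometric series: `(z - p) / (1 - p̄ z) = -p + (1 - |p|²) z ∑ (p̄ z)^k`. -/
theorem hasSum_moebiusCoeff {p : ℂ} (hp : ‖p‖ < 1) (x : S) :
    HasSum (fun n : ℤ => moebiusCoeff p n * fourier n x) (moebiusTrace p x) := by
  have hg := (hasSum_geometric_of_norm_lt_one (norm_conj_mul_circlePoint_lt hp x)).mul_left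
    (((1 - ‖p‖ ^ 2 : ℝ) : ℂ) * circlePoint x)
  have hg' : HasSum (fun k : ℕ => moebiusCoeff p ((k + 1 : ℕ) : ℤ) * fourier ((k + 1 : ℕ) : ℤ) x)
      (((1 - ‖p‖ ^ 2 : ℝ) : ℂ) * circlePoint x * (1 - starRingEnd ℂ p * circlePoint x)⁻¹) := by
    refine hg.congr_fun fun k => ?_
    rw [moebiusCoeff_natCast_succ, fourier_natCast, mul_pow]
    ring
  have h := hasSum_int_of_succ (f := fun n : ℤ => moebiusCoeff p n * fourier n x)
    (fun n hn => by simp only [moebiusCoeff_of_notMem_range p n hn, zero_mul]) hg'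
  have h0 : moebiusCoeff p 0 = -p := rfl
  have hne := one_sub_conj_mul_ne_zero hp x
  have hval : moebiusTrace p x = ((1 - ‖p‖ ^ 2 : ℝ) : ℂ) * circlePoint x *
      (1 - starRingEnd ℂ p * circlePoint x)⁻¹ + moebiusCoeff p 0 * fourier 0 x := by
    rw [h0, moebiusTrace, ofReal_one_sub_norm_sq, fourier_zero, div_eq_iff hne, add_mul,
      mul_assoc _ _⁻¹, inv_mul_cancel₀ hne, mul_one]
    ring
  rw [hval]
  exact h

theorem fourierCoeff_moebiusTrace {p : ℂ} (hp : ‖p‖ < 1) (n : ℤ) :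
    fourierCoeff (moebiusTrace p) n = moebiusCoeff p n := by
  have hs : Summable fun n => ‖moebiusCoeff p n‖ := by
    refine (hasSum_int_of_succ (f := fun n => ‖moebiusCoeff p n‖)
      (fun n hn => by simp only [moebiusCoeff_of_notMem_range p n hn, norm_zero])
      (s := ‖((1 - ‖p‖ ^ 2 : ℝ) : ℂ)‖ * (1 - ‖p‖)⁻¹) ?_).summable
    refine ((hasSum_geometric_of_lt_one (norm_nonneg p) hp).mul_left _).congr_fun fun k => ?_
    rw [moebiusCoeff_natCast_succ, norm_mul, norm_pow, RCLike.norm_conj]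
  rw [← fourierCoeff_tsum hs n]
  congr 1
  ext x
  exact (hasSum_moebiusCoeff hp x).tsum_eq.symm

theorem hasSum_succ_mul_geometric {𝕜 : Type*} [NormedField 𝕜] [CompleteSpace 𝕜] {r : 𝕜}
    (hr : ‖r‖ < 1) : HasSum (fun k : ℕ => ((k : 𝕜) + 1) * r ^ k) (((1 - r) ^ 2)⁻¹) := by
  have h := (hasSum_coe_mul_geometric_of_norm_lt_one hr).add (hasSum_geometric_of_norm_lt_one hr)
  have hne : 1 - r ≠ 0 := by
    intro h
    rw [← sub_eq_zero.mp h, norm_one] at hr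
    exact lt_irrefl _ hr
  convert h using 1
  · ext k; ring
  · field_simp; ring

/-- This is conformal invariance of the Dirichlet energy, verified by `(1 - q)² ∑ (k + 1) q^k = 1`
with `q = |p|²`. -/
theorem hasSum_energy_moebiusTrace {p : ℂ} (hp : ‖p‖ < 1) :
    HasSum (fun n : ℤ => |(n : ℝ)| * ‖fourierCoeff (moebiusTrace p) n‖ ^ 2) 1 := by
  simp_rw [fourierCoeff_moebiusTrace hp]
  have hq : ‖p‖ ^ 2 < 1 := by
    have := norm_nonneg p
    nlinarith
  have hg := (hasSum_succ_mul_geometric (𝕜 := ℝ) (r := ‖p‖ ^ 2)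
    (by rwa [Real.norm_of_nonneg (by positivity)])).mul_left ((1 - ‖p‖ ^ 2) ^ 2)
  rw [mul_inv_cancel₀ (pow_ne_zero 2 (by linarith))] at hg
  have h := hasSum_int_of_succ (f := fun n : ℤ => |(n : ℝ)| * ‖moebiusCoeff p n‖ ^ 2)
    (fun n hn => by simp [moebiusCoeff_of_notMem_range p n hn]) (s := 1) (by
      refine hg.congr_fun fun k => ?_
      rw [moebiusCoeff_natCast_succ, norm_mul, norm_pow, RCLike.norm_conj, Complex.norm_real,
        Real.norm_of_nonneg (by linarith), Int.cast_natCast, abs_of_nonneg (by positivity)]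
      push_cast
      ring)
  simpa using h

/-- No negative frequencies occur, so `Λ` acts as `z d/dz`. -/
theorem dtn_moebiusTrace {p : ℂ} (hp : ‖p‖ < 1) (x : S) :
    dtn (moebiusTrace p) x = ((1 - ‖p‖ ^ 2 : ℝ) : ℂ) * circlePoint x /
      (1 - starRingEnd ℂ p * circlePoint x) ^ 2 := by
  unfold dtn
  simp_rw [fourierCoeff_moebiusTrace hp]
  have hg := (hasSum_succ_mul_geometric (norm_conj_mul_circlePoint_lt hp x)).mul_left
    (((1 - ‖p‖ ^ 2 : ℝ) : ℂ) * circlePoint x)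
  have h := hasSum_int_of_succ
    (f := fun n : ℤ => ((|n| : ℤ) : ℂ) * moebiusCoeff p n * fourier n x)
    (fun n hn => by simp [moebiusCoeff_of_notMem_range p n hn])
    (s := ((1 - ‖p‖ ^ 2 : ℝ) : ℂ) * circlePoint x *
      ((1 - starRingEnd ℂ p * circlePoint x) ^ 2)⁻¹) (by
      refine hg.congr_fun fun k => ?_
      rw [moebiusCoeff_natCast_succ, fourier_natCast, mul_pow, abs_of_nonneg (by positivity)]
      push_cast
      ring)
  rw [h.tsum_eq]
  simp [div_eq_mul_inv]

theorem isSmooth_circlePoint : IsSmooth circlePoint := by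
  have : (fun θ : ℝ => circlePoint (θ : S)) = fun θ : ℝ => Complex.exp (Complex.I * θ) :=
    funext circlePoint_coe
  unfold IsSmooth
  rw [this]
  exact Complex.contDiff_exp.comp (contDiff_const.mul Complex.ofRealCLM.contDiff)

theorem isSmooth_moebiusTrace {p : ℂ} (hp : ‖p‖ < 1) : IsSmooth (moebiusTrace p) := by
  have h1 : ContDiff ℝ ∞ fun θ : ℝ => circlePoint (θ : S) - p :=
    isSmooth_circlePoint.sub (isSmooth_const p)
  have h2 : ContDiff ℝ ∞ fun θ : ℝ => 1 - starRingEnd ℂ p * circlePoint (θ : S) :=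
    (isSmooth_const (1 : ℂ)).sub ((isSmooth_const (starRingEnd ℂ p)).mul isSmooth_circlePoint)
  have h3 := h1.mul (h2.inv fun θ => one_sub_conj_mul_ne_zero hp (θ : S))
  have h4 : (fun θ : ℝ => moebiusTrace p (θ : S)) = fun θ : ℝ => (circlePoint (θ : S) - p) *
      (fun θ : ℝ => 1 - starRingEnd ℂ p * circlePoint (θ : S))⁻¹ θ :=
    funext fun θ => div_eq_mul_inv _ _
  unfold IsSmooth
  rw [h4]
  exact h3

theorem circlePoint_mul_conj (x : S) : circlePoint x * starRingEnd ℂ (circlePoint x) = 1 := by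
  rw [Complex.mul_conj, Complex.normSq_eq_norm_sq, norm_circlePoint]
  simp

theorem one_sub_conj_mul_circlePoint (p : ℂ) (x : S) :
    1 - starRingEnd ℂ p * circlePoint x =
      circlePoint x * starRingEnd ℂ (circlePoint x - p) := by
  rw [map_sub]
  linear_combination -circlePoint_mul_conj x

theorem norm_moebiusTrace {p : ℂ} (hp : ‖p‖ < 1) (x : S) : ‖moebiusTrace p x‖ = 1 := by
  have h : ‖1 - starRingEnd ℂ p * circlePoint x‖ = ‖circlePoint x - p‖ := by
    rw [one_sub_conj_mul_circlePoint, norm_mul, norm_circlePoint, one_mul, RCLike.norm_conj]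
  rw [moebiusTrace, norm_div, h, div_self]
  rw [← h, norm_ne_zero_iff]
  exact one_sub_conj_mul_ne_zero hp x

/-- If the Möbius trace is an eigenfunction, then the weight is the pull-back of a constant. -/
theorem weight_eq_of_dtn_moebiusTrace {a : S → ℝ} (hpos : ∀ x, 0 < a x) {p : ℂ} (hp : ‖p‖ < 1)
    {x : S} (h : dtn (moebiusTrace p) x = ((a x)⁻¹ : ℝ) * moebiusTrace p x) :
    a x * (1 - ‖p‖ ^ 2) = ‖circlePoint x - p‖ ^ 2 := by
  have hne := one_sub_conj_mul_ne_zero hp x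
  have hax : (a x : ℂ) ≠ 0 := by exact_mod_cast (hpos x).ne'
  have hz : circlePoint x ≠ 0 := fun h0 => by
    have := norm_circlePoint x
    rw [h0, norm_zero] at this
    exact zero_ne_one this
  rw [dtn_moebiusTrace hp, moebiusTrace] at h
  push_cast [-Complex.ofReal_sub] at h
  have h1 : (a x : ℂ) * ((1 - ‖p‖ ^ 2 : ℝ) : ℂ) * circlePoint x =
      (circlePoint x - p) * (1 - starRingEnd ℂ p * circlePoint x) := by
    generalize 1 - starRingEnd ℂ p * circlePoint x = D at h hne ⊢
    field_simp at h
    linear_combination h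
  rw [one_sub_conj_mul_circlePoint, mul_left_comm, Complex.mul_conj, Complex.normSq_eq_norm_sq,
    mul_comm] at h1
  have h2 := mul_left_cancel₀ hz h1
  exact_mod_cast h2

/-! ### Conformal equivalence with the constant weight. -/

/-- The conformal automorphism `z ↦ (z + p) / (1 + p̄ z)` of the disk. -/
def diskMap (p z : ℂ) : ℂ := (z + p) / (1 + starRingEnd ℂ p * z)

/-- Besides nonvanishing, the positive real part keeps `1 + p̄ z` off the branch cut of the
logarithm in `angleMap`. -/
theorem one_add_conj_mul_re_pos {p z : ℂ} (hp : ‖p‖ < 1) (hz : ‖z‖ ≤ 1) :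
    0 < (1 + starRingEnd ℂ p * z).re := by
  have h1 : ‖starRingEnd ℂ p * z‖ < 1 := by
    rw [norm_mul, RCLike.norm_conj]
    have := norm_nonneg p
    nlinarith [norm_nonneg z]
  have h2 := (abs_le.mp (Complex.abs_re_le_norm (starRingEnd ℂ p * z))).1
  rw [Complex.add_re, Complex.one_re]
  linarith

theorem one_add_conj_mul_ne_zero {p z : ℂ} (hp : ‖p‖ < 1) (hz : ‖z‖ ≤ 1) :
    1 + starRingEnd ℂ p * z ≠ 0 := fun h => by
  have := one_add_conj_mul_re_pos hp hz
  rw [h, Complex.zero_re] at this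
  exact lt_irrefl _ this

theorem normSq_one_add_sub (p z : ℂ) :
    Complex.normSq (1 + starRingEnd ℂ p * z) - Complex.normSq (z + p) =
      (1 - Complex.normSq p) * (1 - Complex.normSq z) := by
  simp [Complex.normSq_apply]
  ring

theorem norm_diskMap_lt {p z : ℂ} (hp : ‖p‖ < 1) (hz : ‖z‖ < 1) : ‖diskMap p z‖ < 1 := by
  have hne := one_add_conj_mul_ne_zero hp hz.le
  have h := normSq_one_add_sub p z
  simp only [Complex.normSq_eq_norm_sq] at h
  have h1 : 0 < 1 - ‖p‖ ^ 2 := by nlinarith [norm_nonneg p]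
  have h2 : 0 < 1 - ‖z‖ ^ 2 := by nlinarith [norm_nonneg z]
  have h3 := mul_pos h1 h2
  rw [diskMap, norm_div, div_lt_one (norm_pos_iff.mpr hne)]
  refine lt_of_pow_lt_pow_left₀ 2 (norm_nonneg _) ?_
  linarith

theorem diskMap_neg_diskMap {p z : ℂ} (hp : ‖p‖ < 1) (hz : ‖z‖ < 1) :
    diskMap (-p) (diskMap p z) = z := by
  have hne := one_add_conj_mul_ne_zero hp hz.le
  have hne2 := one_add_conj_mul_ne_zero (p := -p) (by rwa [norm_neg]) (norm_diskMap_lt hp hz).le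
  rw [diskMap, div_eq_iff hne2, diskMap, map_neg]
  generalize hD : 1 + starRingEnd ℂ p * z = D at hne
  field_simp
  rw [← hD]
  ring

theorem isConformalDiskMap_diskMap {p : ℂ} (hp : ‖p‖ < 1) : IsConformalDiskMap (diskMap p) := by
  have hball : ∀ z ∈ Metric.ball (0 : ℂ) 1, ‖z‖ < 1 := fun z hz => by simpa using hz
  have hp' : ‖-p‖ < 1 := by rwa [norm_neg]
  refine ⟨fun z hz => ?_, ?_, fun z hz => ?_⟩
  · have h1 : DifferentiableAt ℂ (fun z : ℂ => z + p) z := by fun_prop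
    have h2 : DifferentiableAt ℂ (fun z : ℂ => 1 + starRingEnd ℂ p * z) z := by fun_prop
    exact (h1.div h2 (one_add_conj_mul_ne_zero hp (hball z hz).le)).differentiableWithinAt
  · refine Set.InvOn.bijOn (f' := diskMap (-p)) ⟨fun z hz => ?_, fun z hz => ?_⟩
      (fun z hz => ?_) (fun z hz => ?_)
    · exact diskMap_neg_diskMap hp (hball z hz)
    · have := diskMap_neg_diskMap hp' (hball z hz)
      rwa [neg_neg] at this
    · simpa using norm_diskMap_lt hp (hball z hz)
    · simpa using norm_diskMap_lt hp' (hball z hz)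
  · have h1 : ContinuousAt (fun z : ℂ => z + p) z := by fun_prop
    have h2 : ContinuousAt (fun z : ℂ => 1 + starRingEnd ℂ p * z) z := by fun_prop
    exact (h1.div h2 (one_add_conj_mul_ne_zero hp (by simpa using hz))).continuousWithinAt

/-- The angular lift of the boundary map of `diskMap p`. -/
def angleMap (p : ℂ) (θ : ℝ) : ℝ :=
  θ - 2 * (Complex.log (1 + starRingEnd ℂ p * Complex.exp (Complex.I * θ))).im

theorem norm_exp_I_mul (θ : ℝ) : ‖Complex.exp (Complex.I * θ)‖ = 1 := by
  rw [mul_comm, Complex.norm_exp_ofReal_mul_I]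

theorem mem_slitPlane_one_add {p : ℂ} (hp : ‖p‖ < 1) (θ : ℝ) :
    1 + starRingEnd ℂ p * Complex.exp (Complex.I * θ) ∈ Complex.slitPlane :=
  Or.inl (one_add_conj_mul_re_pos hp (norm_exp_I_mul θ).le)

theorem contDiff_angleMap {p : ℂ} (hp : ‖p‖ < 1) : ContDiff ℝ ∞ (angleMap p) := by
  have h1 : ContDiff ℝ ∞ fun θ : ℝ => 1 + starRingEnd ℂ p * Complex.exp (Complex.I * θ) :=
    contDiff_const.add (contDiff_const.mul
      (Complex.contDiff_exp.comp (contDiff_const.mul Complex.ofRealCLM.contDiff)))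
  have h2 : ContDiff ℝ ∞ fun θ : ℝ =>
      Complex.log (1 + starRingEnd ℂ p * Complex.exp (Complex.I * θ)) := by
    refine contDiff_iff_contDiffAt.mpr fun θ => ?_
    exact ((Complex.contDiffAt_log (mem_slitPlane_one_add hp θ)).restrict_scalars ℝ).comp θ
      h1.contDiffAt
  exact contDiff_id.sub (contDiff_const.mul (Complex.imCLM.contDiff.comp h2))

theorem deriv_angleMap {p : ℂ} (hp : ‖p‖ < 1) (θ : ℝ) :
    deriv (angleMap p) θ = (1 - ‖p‖ ^ 2) /
      ‖1 + starRingEnd ℂ p * Complex.exp (Complex.I * θ)‖ ^ 2 := by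
  set z := Complex.exp (Complex.I * θ) with hz
  have hexp : HasDerivAt (fun θ : ℝ => Complex.exp (Complex.I * θ)) (z * Complex.I) θ := by
    have h1 : HasDerivAt (fun θ : ℝ => Complex.I * (θ : ℂ)) Complex.I θ := by
      simpa using (Complex.ofRealCLM.hasDerivAt (x := θ)).const_mul Complex.I
    exact h1.cexp
  have hlog := ((hexp.const_mul (starRingEnd ℂ p)).const_add 1).clog_real
    (mem_slitPlane_one_add hp θ)
  have him := Complex.imCLM.hasFDerivAt.comp_hasDerivAt θ hlog
  have hd := (hasDerivAt_id θ).sub (him.const_mul 2)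
  have hd' : HasDerivAt (angleMap p)
      (1 - 2 * (starRingEnd ℂ p * (z * Complex.I) / (1 + starRingEnd ℂ p * z)).im) θ := hd
  rw [hd'.deriv]
  have hne : 1 + starRingEnd ℂ p * z ≠ 0 :=
    one_add_conj_mul_ne_zero hp (norm_exp_I_mul θ).le
  have hu : ‖starRingEnd ℂ p * z‖ = ‖p‖ := by
    rw [norm_mul, RCLike.norm_conj, hz, norm_exp_I_mul, mul_one]
  have hassoc : starRingEnd ℂ p * (z * Complex.I) = (starRingEnd ℂ p * z) * Complex.I := by ring
  rw [hassoc, ← hu]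
  generalize starRingEnd ℂ p * z = u at hne ⊢
  have hpos : 0 < Complex.normSq (1 + u) := Complex.normSq_pos.mpr hne
  rw [← Complex.normSq_eq_norm_sq, ← Complex.normSq_eq_norm_sq, eq_div_iff hpos.ne', sub_mul,
    Complex.div_im]
  field_simp
  simp [Complex.normSq_apply]
  ring

/-- With `q = 1 + p̄ z` and `|z| = 1`, one has `z + p = z q̄`; so the image is `z q̄ / q`, whose
argument is `θ - 2 arg q`. -/
theorem exp_angleMap {p : ℂ} (hp : ‖p‖ < 1) (θ : ℝ) :
    Complex.exp (Complex.I * angleMap p θ) = diskMap p (Complex.exp (Complex.I * θ)) := by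
  set z := Complex.exp (Complex.I * θ) with hz
  set q := 1 + starRingEnd ℂ p * z with hq
  have hne : q ≠ 0 := one_add_conj_mul_ne_zero hp (norm_exp_I_mul θ).le
  have harg : q.arg ≠ Real.pi :=
    (Complex.mem_slitPlane_iff_arg.mp (mem_slitPlane_one_add hp θ)).1
  have h1 : Complex.I * (angleMap p θ : ℂ) =
      Complex.I * θ + (starRingEnd ℂ (Complex.log q) - Complex.log q) := by
    have : starRingEnd ℂ (Complex.log q) - Complex.log q =
        -(2 * ((Complex.log q).im : ℂ) * Complex.I) := by
      rw [← neg_sub, Complex.sub_conj]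
      push_cast
      ring
    rw [this, angleMap]
    push_cast
    ring
  have h2 : Complex.exp (starRingEnd ℂ (Complex.log q)) = starRingEnd ℂ q := by
    rw [Complex.exp_conj, Complex.exp_log hne]
  have hzz : z * starRingEnd ℂ z = 1 := by
    rw [Complex.mul_conj, Complex.normSq_eq_norm_sq, hz, norm_exp_I_mul]
    simp
  rw [h1, Complex.exp_add, Complex.exp_sub, h2, Complex.exp_log hne, diskMap, ← hz, ← hq,
    ← mul_div_assoc]
  congr 1
  rw [hq, map_add, map_one, map_mul, Complex.conj_conj]
  linear_combination p * hzz

/-- The equivalence uses `diskMap p`, the inverse of the balancing map; for its lift `ψ` the weight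
formula says exactly `a ∘ ψ = ψ'`. -/
theorem conformallyEquivalent_one_of_weight_eq {a : S → ℝ} {p : ℂ} (hp : ‖p‖ < 1)
    (h : ∀ x, a x * (1 - ‖p‖ ^ 2) = ‖circlePoint x - p‖ ^ 2) :
    ConformallyEquivalent a (fun _ => 1) := by
  refine ⟨diskMap p, Or.inl (isConformalDiskMap_diskMap hp), angleMap p, contDiff_angleMap hp,
    exp_angleMap hp, fun θ => ?_⟩
  have hp2 : 0 < 1 - ‖p‖ ^ 2 := by nlinarith [norm_nonneg p]
  set z := Complex.exp (Complex.I * θ) with hz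
  have hne : 1 + starRingEnd ℂ p * z ≠ 0 :=
    one_add_conj_mul_ne_zero hp (norm_exp_I_mul θ).le
  have hnorm : 0 < ‖1 + starRingEnd ℂ p * z‖ := norm_pos_iff.mpr hne
  have h1 := h (angleMap p θ : S)
  have h2 : circlePoint (angleMap p θ : S) - p =
      ((1 - ‖p‖ ^ 2 : ℝ) : ℂ) * z / (1 + starRingEnd ℂ p * z) := by
    rw [circlePoint_coe, exp_angleMap hp, diskMap, ← hz, ofReal_one_sub_norm_sq, eq_div_iff hne,
      sub_mul, div_mul_cancel₀ _ hne]
    ring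
  rw [h2, norm_div, norm_mul, Complex.norm_real, hz, norm_exp_I_mul, ← hz, mul_one,
    Real.norm_of_nonneg hp2.le, div_pow] at h1
  have h3 : a (angleMap p θ : S) = (1 - ‖p‖ ^ 2) / ‖1 + starRingEnd ℂ p * z‖ ^ 2 := by
    refine mul_right_cancel₀ hp2.ne' (h1.trans ?_)
    ring
  have hpos : 0 < (1 - ‖p‖ ^ 2) / ‖1 + starRingEnd ℂ p * z‖ ^ 2 := by positivity
  rw [deriv_angleMap hp, h3, ← hz, abs_of_pos hpos, inv_mul_cancel₀ hpos.ne']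

/-! ### Weinstock's inequality and the conclusion. -/

/-- Weinstock's inequality with its equality case. -/
theorem one_lt_norm_weightOp {a : S → ℝ} (ha : IsSmooth a) (hpos : ∀ x, 0 < a x)
    (hm : HasUnitMass a) (hconf : ¬ ConformallyEquivalent a (fun _ => 1)) :
    1 < ‖weightOp ha hpos‖ := by
  have hmean : ∫ x, (a x)⁻¹ ∂haarAddCircle = 1 := by
    have := hm
    rw [HasUnitMass, integral_complex_ofReal] at this
    exact_mod_cast this
  obtain ⟨p, hp, hbal⟩ := exists_balanced (ha.inv hpos).continuous hmean
  refine (one_lt_norm_or_dtn_eq ha hpos hm (isSmooth_moebiusTrace hp) (norm_moebiusTrace hp)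
    (hasSum_energy_moebiusTrace hp) hbal).resolve_right fun h => hconf ?_
  exact conformallyEquivalent_one_of_weight_eq hp fun x =>
    weight_eq_of_dtn_moebiusTrace hpos hp (h x)

theorem hasUnitMass_of_integral {a : S → ℝ}
    (h : (1 / (2 * Real.pi)) * ∫ θ in (0 : ℝ)..(2 * Real.pi), 1 / a (θ : S) = 1) :
    HasUnitMass a := by
  rw [HasUnitMass, integral_complex_ofReal, integral_haar_eq, ← one_div]
  simp only [← one_div]
  rw [h, Complex.ofReal_one]

end Steklov

end

theorem proposition5 (a : Steklov.S → ℝ) (ha : Steklov.IsSmooth a) (hpos : ∀ x, 0 < a x)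
    (hnorm : (1 / (2 * Real.pi)) * ∫ θ in (0 : ℝ)..(2 * Real.pi), 1 / a (θ : Steklov.S) = 1)
    (hconf : ¬ Steklov.ConformallyEquivalent a (fun _ => 1)) :
    ∃ s_a : ℝ, 1 < s_a ∧ ∀ s : ℝ, s_a ≤ s →
      Summable (fun k : ℕ => (Steklov.eigenvalue a (k + 1) : ℂ) ^ (-(s : ℂ))) ∧
      0 < iteratedDeriv 2 (fun z : ℂ => Steklov.zeta a z - 2 * riemannZeta z) (s : ℂ) := by
  have hm := Steklov.hasUnitMass_of_integral hnorm
  obtain ⟨c, hc, hl⟩ := Steklov.exists_linear_le_eigenvalue ha hpos hm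
  -- The sequence is shifted by one: the zero eigenvalue is dropped and `l 0` is `λ₁`.
  exact Steklov.exists_iteratedDeriv_two_pos (l := fun k => Steklov.eigenvalue a (k + 1)) hc hl
    (Steklov.eigenvalue_one_lt_one ha hpos hm (Steklov.one_lt_norm_weightOp ha hpos hm hconf))
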